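/- **Setting.** Let $\mathcal X$ be the toric Deligne–Mumford stack of a stacky fan $(\mathbf N,\Sigma,b_1,\dots,b_m)$: $\mathbf N$ is a finitely generated abelian group (torsion allowed), $\Sigma$ is a complete rational simplicial fan in $\mathbf N\otimes\mathbb Q$ whose rays are spanned by the images $\bar b_1,\dots,\bar b_m$. Let $s_1,\dots,s_l$ be box elements (elements $v\in\mathbf N$ with $\bar v=\sum_{i\in\sigma}c_i\bar b_i$, $0\le c_i<1$, $\sigma\in\Sigma$) of age $\sum c_i\le 1$ such that $b_1,\dots,b_m,s_1,\dots,s_l$ generate $\mathbf N$; put $b_{m+k}:=s_k$. Let $\mathbb L^S=\ker(\mathbb Z^{m+l}\to\mathbf N)$, let $D_i^S\in(\mathbb L^S)^\vee=\mathrm{Hom}(\mathbb L^S,\mathbb Z)$ be the $i$-th coordinate, and $\rho^S=\sum_{i=1}^{m+l}D_i^S$. A set $I\subseteq\{1,\dots,m+l\}$ is an anticone if it contains $m+1,\dots,m+l$ and $\{\bar b_i\}_{i\notin I}$ spans a cone of $\Sigma$. Let $C^S=\bigcap_{I\text{ anticone}}\sum_{i\in I}\mathbb R_{>0}D_i^S$,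 and assume $\rho^S\in \mathrm{cl}(C^S)$. Fix an integral basis $p_1^S,\dots,p_{r+l}^S$ of $(\mathbb L^S)^\vee$ (so $r=m-\operatorname{rk}\mathbf N$) contained in $\mathrm{cl}(C^S)$ with $p^S_{r+1},\dots,p^S_{r+l}\in\sum_{k=1}^{l}\mathbb R_{\ge0}D_{m+k}^S$, and write $D_j^S=\sum_a m_{ja}p_a^S$. Let $\mathbb K_{\rm eff}$ be the set of $d\in\mathbb L^S\otimes\mathbb Q$ for which $\{i:\langle D_i^S,d\rangle\in\mathbb Z_{\ge0}\}$ is an anticone, and put $v(d)=\sum_{i=1}^{m+l}\lceil\langle D_i^S,d\rangle\rceil b_i\in\mathbf N$ and $y^d=\prod_a y_a^{\langle p_a^S,d\rangle}$. Let $H^*_{orb}(\mathcal X)=\bigoplus_{v\in \mathrm{Box}}H^*(\mathcal X_v;\mathbb Q)$, let $\mathbf 1_v$ be the unit class of the sector $v$ (so $1=\mathbf 1_0$), let $D_i$ ($i\le m$) be the toric divisor classes and $D_{m+k}=0$; $H^*(\mathcal X)$ acts on $H^*_{orb}(\mathcal X)$ by restriction to the sectors. Let $p_a$ be the image of $p_a^S$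 in $H^2(\mathcal X;\mathbb Q)$ under $D_i^S\mapsto D_i$ (so $p_{r+k}=0$). The $I$-function of $\mathcal X$ is the formal series $$I_{\mathcal X}(y,z)=e^{\sum_{a=1}^r p_a\log y_a/z}\sum_{d\in\mathbb K_{\rm eff}}\ \prod_{i=1}^{m+l}\frac{\prod_{k\ge\lceil\langle D_i^S,d\rangle\rceil}(D_i+(\langle D_i^S,d\rangle-k)z)}{\prod_{k\ge0}(D_i+(\langle D_i^S,d\rangle-k)z)}\ y^d\,\mathbf 1_{v(d)},$$ expanded in powers of $z^{-1}$; the mirror map $\tau(y)$ is its coefficient of $z^{-1}$ (so $I_{\mathcal X}=1+\tau(y)z^{-1}+O(z^{-2})$), and the Batyrev element is $$\tilde D_j(y)=\sum_{a=1}^{r+l}m_{ja}\frac{\partial\tau(y)}{\partial\log y_a},\qquad 1\le j\le m+l.$$ For $1\le j\le m+l$ let $\mathcal E_j\to\mathbb P^1$ be the associated bundle with fibre $\mathcal X$: the toric Deligne–Mumford stack with group $\mathbf N\oplus\mathbb Z$, rays $(b_i,0)$ $(i\le m)$, $(0,1)$, $(b_j,-1)$, extending vectors $(s_k,0)$, whose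 cones are spanned by the $(b_i,0)$, $i\in\sigma$, for a cone $\sigma\in\Sigma$, together with at most one of $(0,1)$, $(b_j,-1)$. Its kernel lattice is split as $\mathbb L^S\oplus\mathbb Z$ so that its divisor forms are $\hat D_i^S=(D_i^S,0)$ for $i\ne j$, $\hat D_j^S=(D_j^S,-1)$, $\hat D_{m+l+1}^S=\hat D_{m+l+2}^S=(0,1)=:p_0^S$. Let $I_{\mathcal E_j}$ be its $I$-function, defined as above with the basis $p_0^S,(p_1^S,0),\dots,(p_{r+l}^S,0)$, the variables $y_0,\dots,y_{r+l}$ and the prefactor $e^{\sum_{a=0}^rp_a\log y_a/z}$. Let $G_1^{(j)}(y)$, a fractional power series in $y_1,\dots,y_{r+l}$ with values in $H^*_{orb}(\mathcal E_j)$, be the coefficient of $y_0z^{-2}$ in $e^{-\sum_{a=0}^rp_a\log y_a/z}I_{\mathcal E_j}$, and let $\imath:\mathcal X\to\mathcal E_j$ be the inclusion of a fibre. **Lemma.** For every $1\le j\le m+l$: 1. $\tilde D_j(y)=\imath^*G_1^{(j)}(y)$. 2. $$\tilde D_j=D_j+\sum_{i=1}^mD_i\sum_{\substack{d\in\mathbb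 L^S\otimes\mathbb Q,\ \langle\rho^S,d\rangle=0\\ \langle D_i^S,d\rangle\in\mathbb Z_{<0}\\ \langle D_k^S,d\rangle\in\mathbb Z_{\ge0}\ \forall k\ne i}}C_d\langle D_j^S,d\rangle y^d\,\mathbf 1_{v(d)}+\sum_{\substack{d\in\mathbb K_{\rm eff}\\ \sum_{i=1}^{m+l}\lceil\langle D_i^S,d\rangle\rceil=1\\ \langle D_i^S,d\rangle\notin\mathbb Z_{<0}\ \forall i}}C_d\langle D_j^S,d\rangle y^d\,\mathbf 1_{v(d)},$$ where, with $k$ running over integers, $$C_d=\prod_{i:\langle D_i^S,d\rangle<0}\ \prod_{\langle D_i^S,d\rangle<k<0}(\langle D_i^S,d\rangle-k)\ \prod_{i:\langle D_i^S,d\rangle>0}\ \prod_{0\le k<\langle D_i^S,d\rangle}(\langle D_i^S,d\rangle-k)^{-1}.$$ If $\mathbf N$ is torsion-free, then $v(d)=0$ for all $d$ in the first sum, so that the factor $\mathbf 1_{v(d)}=1$ may be omitted there. -/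

import Mathlib

open scoped TensorProduct

noncomputable section

/-! ### Extended stacky fans -/

/-- The data of an `S`-extended stacky fan: the vectors `b_i` (`i : ι`, the rays), the extending
vectors `s_k` (`k : κ`), and the cones of the fan, each cone being recorded by the set of the rays
that generate it. -/
structure ExtStackyFan (N : Type*) (ι κ : Type*) where
  ray : ι → N
  ext : κ → N
  cones : Set (Finset ι)

namespace ExtStackyFan

variable {N : Type*} [AddCommGroup N] {ι κ : Type*} [Fintype ι] [Fintype κ]

/-- The image `v̄` of `v` in `N ⊗ ℚ`. -/
def bar (v : N) : ℚ ⊗[ℤ] N := 1 ⊗ₜ[ℤ] v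

/-- All vectors `b_1, …, b_m, s_1, …, s_l`. -/
def vec (X : ExtStackyFan N ι κ) : ι ⊕ κ → N := Sum.elim X.ray X.ext

/-- The cone in `N ⊗ ℚ` spanned by the rays in `τ`. -/
def coneOf (X : ExtStackyFan N ι κ) (τ : Finset ι) : Set (ℚ ⊗[ℤ] N) :=
  {x | ∃ c : ι → ℚ, (∀ i, 0 ≤ c i) ∧ (∀ i, i ∉ τ → c i = 0) ∧ x = ∑ i, c i • bar (X.ray i)}

/-- The cones form a complete rational simplicial fan in `N ⊗ ℚ` whose rays are spanned by the
vectors `b̄_i`. -/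
structure IsCompleteSimplicial (X : ExtStackyFan N ι κ) : Prop where
  face : ∀ τ ∈ X.cones, ∀ σ ⊆ τ, σ ∈ X.cones
  ray_mem : ∀ i, {i} ∈ X.cones
  simplicial : ∀ τ ∈ X.cones, LinearIndependent ℚ (fun i : τ => bar (X.ray i))
  inter : ∀ σ ∈ X.cones, ∀ τ ∈ X.cones, ∀ x, x ∈ X.coneOf σ → x ∈ X.coneOf τ →
    ∃ ρ : Finset ι, ρ ⊆ σ ∧ ρ ⊆ τ ∧ x ∈ X.coneOf ρ
  complete : ∀ x, ∃ τ ∈ X.cones, x ∈ X.coneOf τ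

/-- `v̄ = ∑_{i ∈ τ} c_i b̄_i` with `0 ≤ c_i < 1`. -/
def IsBoxRep (X : ExtStackyFan N ι κ) (τ : Finset ι) (v : N) (c : ι → ℚ) : Prop :=
  (∀ i, 0 ≤ c i ∧ c i < 1) ∧ (∀ i, i ∉ τ → c i = 0) ∧ bar v = ∑ i, c i • bar (X.ray i)

/-- The box elements. -/
def Box (X : ExtStackyFan N ι κ) : Set N := {v | ∃ τ ∈ X.cones, ∃ c, X.IsBoxRep τ v c}

/-- The extending vectors are box elements of age at most one, and together with the `b_i` they
generate `N`. -/
structure IsBoxExtension (X : ExtStackyFan N ι κ) : Prop where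
  age_le : ∀ k, ∃ τ ∈ X.cones, ∃ c, X.IsBoxRep τ (X.ext k) c ∧ ∑ i, c i ≤ 1
  generates : AddSubgroup.closure (Set.range X.vec) = ⊤

/-- `β^S : ℤ^{m+l} → N`. -/
def betaS (X : ExtStackyFan N ι κ) : (ι ⊕ κ → ℤ) →ₗ[ℤ] N := Fintype.linearCombination ℤ X.vec

/-- `𝕃^S`, the kernel of `β^S`. -/
abbrev L (X : ExtStackyFan N ι κ) : Submodule ℤ (ι ⊕ κ → ℤ) := LinearMap.ker X.betaS

/-- `𝕃^S ⊗ ℚ`. -/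
abbrev LQ (X : ExtStackyFan N ι κ) : Type _ := ℚ ⊗[ℤ] X.L

/-- The class `D_i^S`, as a linear form on `𝕃^S`. -/
def DS (X : ExtStackyFan N ι κ) (i : ι ⊕ κ) : Module.Dual ℤ X.L :=
  (LinearMap.proj i : (ι ⊕ κ → ℤ) →ₗ[ℤ] ℤ) ∘ₗ X.L.subtype

/-- The pairing of an element of the dual of `𝕃^S` with elements of `𝕃^S ⊗ ℚ`. -/
def pair (X : ExtStackyFan N ι κ) (f : Module.Dual ℤ X.L) : X.LQ →ₗ[ℚ] ℚ :=
  (TensorProduct.AlgebraTensorModule.rid ℤ ℚ ℚ).toLinearMap ∘ₗ LinearMap.baseChange ℚ f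

/-- The `S`-extended anticones: their complements are the cones, seen as sets of rays. -/
def AntiCone (X : ExtStackyFan N ι κ) (I : Set (ι ⊕ κ)) : Prop :=
  (∀ k, Sum.inr k ∈ I) ∧ ∃ τ ∈ X.cones, ∀ i, i ∈ τ ↔ Sum.inl i ∉ I

/-- `f` as a real-valued function on `𝕃^S`; this is how the dual of `𝕃^S`, tensored with `ℝ`, is
viewed inside the space of all functions `𝕃^S → ℝ` with the topology of pointwise convergence. -/
def toReal (X : ExtStackyFan N ι κ) (f : Module.Dual ℤ X.L) : X.L → ℝ := fun d => (f d : ℝ)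

/-- The `S`-extended Kähler cone `⋂_I ∑_{i ∈ I} ℝ_{>0} D_i^S`, over all anticones `I`. -/
def kahlerCone (X : ExtStackyFan N ι κ) : Set (X.L → ℝ) :=
  {f | ∀ I, X.AntiCone I → ∃ a : ι ⊕ κ → ℝ, (∀ i ∈ I, 0 < a i) ∧ (∀ i, i ∉ I → a i = 0) ∧
    f = ∑ i, a i • X.toReal (X.DS i)}

/-- `ρ^S = ∑ D_i^S`. -/
def rhoS (X : ExtStackyFan N ι κ) : Module.Dual ℤ X.L := ∑ i, X.DS i

/-- The set `𝕂_eff`. -/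
def Keff (X : ExtStackyFan N ι κ) : Set X.LQ :=
  {d | X.AntiCone {i | ∃ n : ℕ, X.pair (X.DS i) d = n}}

/-- The reduction function `v(d) = ∑ ⌈⟨D_i^S, d⟩⌉ b_i + ∑ ⌈⟨D_{m+k}^S, d⟩⌉ s_k`. -/
def red (X : ExtStackyFan N ι κ) (d : X.LQ) : N := ∑ i, ⌈X.pair (X.DS i) d⌉ • X.vec i

/-! ### Orbifold cohomology -/

/-- The relations of the rational cohomology of the sector `𝒳_v`: the linear relations
`∑ θ(b_i) x_i` with `θ ∈ Hom(N, ℤ)`, and the Stanley–Reisner relations `∏_{i ∈ J} x_i` for those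
`J` which, joined with the minimal cone of `v`, do not span a cone (a cone contains the minimal
cone of `v` exactly if `v` is a box element of that cone). For `v = 0` these are the usual
relations of the cohomology of a simplicial toric variety. -/
def sectorIdeal (X : ExtStackyFan N ι κ) (v : N) : Ideal (MvPolynomial ι ℚ) :=
  Ideal.span
    ({f | ∃ θ : N →+ ℤ, f = ∑ i, MvPolynomial.C (θ (X.ray i) : ℚ) * MvPolynomial.X i} ∪
     {f | ∃ J : Finset ι, (¬ ∃ τ ∈ X.cones, J ⊆ τ ∧ ∃ c, X.IsBoxRep τ v c) ∧
        f = ∏ i ∈ J, MvPolynomial.X i})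

/-- `H^*(𝒳_v; ℚ)`, where `x_i` is the restriction of the divisor class `D_i`. -/
abbrev SectorCoh (X : ExtStackyFan N ι κ) (v : N) : Type _ := MvPolynomial ι ℚ ⧸ X.sectorIdeal v

/-- `H^*_orb(𝒳) = H^*(I𝒳; ℚ)`, the product over the components of the inertia stack, with its
cup product (by which `H^*(𝒳)` acts on it). -/
abbrev Horb (X : ExtStackyFan N ι κ) : Type _ := ∀ v : X.Box, X.SectorCoh v

/-- The divisor class `D_i`, pulled back to the inertia stack; it is zero for the extended
indices. -/
def divClass (X : ExtStackyFan N ι κ) : ι ⊕ κ → X.Horb :=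
  Sum.elim (fun i v => Ideal.Quotient.mk (X.sectorIdeal v) (MvPolynomial.X i)) (fun _ => 0)

open Classical in
/-- The unit class `𝟏_v` of the sector `v`. -/
def sectorUnit (X : ExtStackyFan N ι κ) (v : N) : X.Horb := fun u => if (u : N) = v then 1 else 0

/-- The divisor class `D_i` as an element of `H²(𝒳) ⊆ H^*_orb(𝒳)`, in the untwisted sector. -/
def D (X : ExtStackyFan N ι κ) (i : ι ⊕ κ) : X.Horb := X.divClass i * X.sectorUnit 0

theorem exists_coeff (X : ExtStackyFan N ι κ) (f : Module.Dual ℤ X.L) :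
    ∃ a : ι ⊕ κ → ℚ, ∀ d : X.L, (f d : ℚ) = ∑ i, a i * ((d : ι ⊕ κ → ℤ) i : ℚ) := by
  classical
  obtain ⟨h, hh⟩ := Module.Baer.extension_property (Module.Baer.of_divisible ℚ)
    X.L.subtype X.L.injective_subtype ((Int.castAddHom ℚ).toIntLinearMap ∘ₗ f)
  refine ⟨fun i => h (Pi.single i 1), fun d => ?_⟩
  have h1 : h (d : ι ⊕ κ → ℤ) = (f d : ℚ) := by
    simpa using LinearMap.congr_fun hh d
  rw [← h1, LinearMap.pi_apply_eq_sum_univ h]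
  refine Finset.sum_congr rfl fun i _ => ?_
  have : (Pi.single i 1 : ι ⊕ κ → ℤ) = fun j => if i = j then 1 else 0 := by
    ext j; simp [Pi.single_apply, eq_comm]
  simp only [this]
  rw [zsmul_eq_mul, mul_comm]

/-- The image in `H²(𝒳; ℚ)` (pulled back to the inertia stack) of an element `f` of the dual of
`𝕃^S`, under the map that sends `D_i^S` to `D_i` for the rays and to zero for the extended
indices. It does not depend on the expression `f = ∑ a_i D_i^S` that is used, because of the
linear relations. -/
def cls (X : ExtStackyFan N ι κ) (f : Module.Dual ℤ X.L) : X.Horb :=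
  ∑ i, (X.exists_coeff f).choose i • X.divClass i

end ExtStackyFan

/-! ### The `I`-function

Laurent series are in the variable `w = z⁻¹`: the coefficient of index `n` is that of `z^{-n}`.
A formal series `∑_e a_e y^e` in fractional powers of variables `y_a`, `a : V`, is the function
`e ↦ a_e` on `V → ℚ`. -/

/-- `D + c z`. -/
def linFactor {H : Type*} [CommRing H] [Algebra ℚ H] (D : H) (c : ℚ) : LaurentSeries H :=
  HahnSeries.C D + HahnSeries.single (-1) (algebraMap ℚ H c)

/-- `∏_{k ≥ ⌈a⌉} (D + (a - k) z) / ∏_{k ≥ 0} (D + (a - k) z)`, with the common factors cancelled;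
the factors left in the denominator have `a - k > 0`, so they are units. -/
def hyperFactor {H : Type*} [CommRing H] [Algebra ℚ H] (D : H) (a : ℚ) : LaurentSeries H :=
  (∏ k ∈ Finset.Ico ⌈a⌉ 0, linFactor D (a - k)) *
    Ring.inverse (∏ k ∈ Finset.Ico 0 ⌈a⌉, linFactor D (a - k))

/-- `y_a ∂/∂y_a` on formal series in fractional powers of the `y_b` whose coefficients are
polynomials in the `log y_b`. -/
def yDeriv {V H : Type*} [CommRing H] [Algebra ℚ H] (a : V)
    (F : (V → ℚ) → MvPolynomial V H) : (V → ℚ) → MvPolynomial V H :=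
  fun e => e a • F e + MvPolynomial.pderiv a (F e)

namespace ExtStackyFan

variable {N : Type*} [AddCommGroup N] {ι κ : Type*} [Fintype ι] [Fintype κ]

/-- The formal series `∑_{d ∈ s} c_d y^d`, where `y^d = ∏_a y_a^{⟨p_a, d⟩}`. -/
def monSum (X : ExtStackyFan N ι κ) {V : Type*} (p : V → Module.Dual ℤ X.L) {A : Type*}
    [AddCommMonoid A] (s : Set X.LQ) (c : X.LQ → A) : (V → ℚ) → A :=
  fun e => ∑ᶠ (d : X.LQ) (_ : d ∈ s ∧ ∀ a, X.pair (p a) d = e a), c d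

/-- The series `e^{-∑ p_a log y_a / z} I`, that is
`∑_{d ∈ 𝕂_eff} ∏_i (hypergeometric factor of D_i at ⟨D_i^S, d⟩) y^d 𝟏_{v(d)}`. -/
def redI (X : ExtStackyFan N ι κ) {V : Type*} (p : V → Module.Dual ℤ X.L) :
    (V → ℚ) → LaurentSeries X.Horb :=
  X.monSum p X.Keff fun d =>
    (∏ i, hyperFactor (X.divClass i) (X.pair (X.DS i) d)) * HahnSeries.C (X.sectorUnit (X.red d))

/-- The `I`-function. Only the variables `y_a`, `a : A`, contribute to the exponential prefactor
`e^{∑ p_a log y_a / z}`. -/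
def I (X : ExtStackyFan N ι κ) {A B : Type*} [Fintype A] (p : A ⊕ B → Module.Dual ℤ X.L) :
    (A ⊕ B → ℚ) → LaurentSeries (MvPolynomial (A ⊕ B) X.Horb) :=
  fun e =>
    ((PowerSeries.rescale
        (∑ a : A, MvPolynomial.C (X.cls (p (Sum.inl a))) * MvPolynomial.X (Sum.inl a))
        (PowerSeries.exp (MvPolynomial (A ⊕ B) X.Horb)) :
          PowerSeries (MvPolynomial (A ⊕ B) X.Horb)) :
      LaurentSeries (MvPolynomial (A ⊕ B) X.Horb)) *
    (X.redI p e).map (MvPolynomial.C : X.Horb →+* MvPolynomial (A ⊕ B) X.Horb)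

/-- The mirror map `τ(y)`: the coefficient of `z⁻¹` in `I(y, z) = 1 + τ(y) z⁻¹ + O(z⁻²)`. -/
def mirrorMap (X : ExtStackyFan N ι κ) {A B : Type*} [Fintype A]
    (p : A ⊕ B → Module.Dual ℤ X.L) : (A ⊕ B → ℚ) → MvPolynomial (A ⊕ B) X.Horb :=
  fun e => (X.I p e).coeff 1

/-- The Batyrev element `∑_a m_{ja} ∂τ(y)/∂log y_a`, where `D_j^S = ∑_a m_{ja} p_a^S`. -/
def batyrev (X : ExtStackyFan N ι κ) {A B : Type*} [Fintype A] [Fintype B]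
    (p : Module.Basis (A ⊕ B) ℤ (Module.Dual ℤ X.L)) (j : ι ⊕ κ) :
    (A ⊕ B → ℚ) → MvPolynomial (A ⊕ B) X.Horb :=
  ∑ a, p.repr (X.DS j) a • yDeriv a (X.mirrorMap p)

/-! ### The associated bundle -/

/-- The extended stacky fan of the associated bundle `ℰ_j` over `ℙ¹`: its rays are `(b_i, 0)`,
`(0, 1)` and `(b_j, -1)` (where `b_{m+k} = s_k`), its extending vectors `(s_k, 0)`. -/
def bundle (X : ExtStackyFan N ι κ) (j : ι ⊕ κ) : ExtStackyFan (N × ℤ) (ι ⊕ Fin 2) κ where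
  ray := Sum.elim (fun i => (X.ray i, 0)) ![(0, 1), (X.vec j, -1)]
  ext := fun k => (X.ext k, 0)
  cones := {τ | (∃ σ ∈ X.cones, ∀ i, i ∈ σ ↔ Sum.inl i ∈ τ) ∧
    ¬ (Sum.inr 0 ∈ τ ∧ Sum.inr 1 ∈ τ)}

open Classical in
/-- On coordinates, the map `(d_i)_i ↦ d + d_{m+l+2} e_j` that projects the kernel lattice of the
bundle to `𝕃^S`. -/
def projCoord (j : ι ⊕ κ) : ((ι ⊕ Fin 2) ⊕ κ → ℤ) →ₗ[ℤ] (ι ⊕ κ → ℤ) :=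
  LinearMap.funLeft ℤ ℤ (Sum.map Sum.inl id) +
    LinearMap.single ℤ (fun _ : ι ⊕ κ => ℤ) j ∘ₗ
      LinearMap.proj (Sum.inl (Sum.inr 1) : (ι ⊕ Fin 2) ⊕ κ)

theorem betaS_projCoord (X : ExtStackyFan N ι κ) (j : ι ⊕ κ) (d : (X.bundle j).L) :
    projCoord j (d : (ι ⊕ Fin 2) ⊕ κ → ℤ) ∈ X.L := by
  obtain ⟨d, hd⟩ := d
  have h := congrArg Prod.fst hd
  simp [betaS, Fintype.linearCombination_apply, bundle, vec, Prod.fst_sum] at h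
  rw [LinearMap.mem_ker]
  simp only [projCoord, LinearMap.add_apply, map_add]
  have h2 : ∀ (_ : DecidableEq (ι ⊕ κ)) (n : ℤ),
      X.betaS (LinearMap.single ℤ (fun _ : ι ⊕ κ => ℤ) j n) = n • X.vec j := by
    intro _ n
    simp only [betaS, Fintype.linearCombination_apply, LinearMap.coe_single]
    rw [Finset.sum_eq_single j] <;> simp +contextual
  simp only [LinearMap.comp_apply, LinearMap.proj_apply]
  rw [h2]
  simp [betaS, Fintype.linearCombination_apply, LinearMap.funLeft_apply, vec]
  rw [← h]
  abel

/-- The projection of the kernel lattice of `ℰ_j` onto the first summand of the splitting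
`𝕃^S ⊕ ℤ`, the second coordinate being `⟨p_0^S, ·⟩`. -/
def proj (X : ExtStackyFan N ι κ) (j : ι ⊕ κ) : (X.bundle j).L →ₗ[ℤ] X.L :=
  LinearMap.codRestrict X.L (projCoord j ∘ₗ (X.bundle j).L.subtype) (X.betaS_projCoord j)

/-- The forms `p_0^S, p_1^S, …, p_{r+l}^S` for the bundle; `p_0^S` has the index `none`, and the
others are composed with the projection to `𝕃^S`. -/
def bundleBasis (X : ExtStackyFan N ι κ) (j : ι ⊕ κ) {A B : Type*}
    (p : A ⊕ B → Module.Dual ℤ X.L) : Option A ⊕ B → Module.Dual ℤ (X.bundle j).L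
  | Sum.inl none => (X.bundle j).DS (Sum.inl (Sum.inr 0))
  | Sum.inl (some a) => p (Sum.inl a) ∘ₗ X.proj j
  | Sum.inr b => p (Sum.inr b) ∘ₗ X.proj j

/-- The exponent of `y_0^n y^e`. -/
def consExp {A B : Type*} (n : ℕ) (e : A ⊕ B → ℚ) : Option A ⊕ B → ℚ
  | Sum.inl none => n
  | Sum.inl (some a) => e (Sum.inl a)
  | Sum.inr b => e (Sum.inr b)

/-- `G_n^{(j)}(y)`: the coefficient of `y_0^n z⁻²` in `e^{-∑_{a=0}^r p_a log y_a / z} I_{ℰ_j}`, a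
formal series in `y_1, …, y_{r+l}` with values in `H^*_orb(ℰ_j)`. -/
def G (X : ExtStackyFan N ι κ) (j : ι ⊕ κ) {A B : Type*}
    (p : A ⊕ B → Module.Dual ℤ X.L) (n : ℕ) : (A ⊕ B → ℚ) → (X.bundle j).Horb :=
  fun e => ((X.bundle j).redI (X.bundleBasis j p) (consExp n e)).coeff 2

/-- The restriction of polynomials to a fibre: the classes of the two fibres over the fixed points
of `ℙ¹` go to zero. -/
def fibrePoly : MvPolynomial (ι ⊕ Fin 2) ℚ →ₐ[ℚ] MvPolynomial ι ℚ :=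
  MvPolynomial.aeval (Sum.elim MvPolynomial.X (fun _ => 0))

set_option linter.unusedSectionVars false in
theorem boxRep_bundle (X : ExtStackyFan N ι κ) (j : ι ⊕ κ) {τ : Finset ι} (hτ : τ ∈ X.cones)
    {v : N} {c : ι → ℚ} (hc : X.IsBoxRep τ v c) :
    τ.map Function.Embedding.inl ∈ (X.bundle j).cones ∧
      (X.bundle j).IsBoxRep (τ.map Function.Embedding.inl) (v, 0) (Sum.elim c (fun _ => 0)) := by
  refine ⟨⟨⟨τ, hτ, by simp⟩, by simp⟩, ?_, ?_, ?_⟩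
  · rintro (i | i)
    · exact hc.1 i
    · simp
  · rintro (i | i) hi
    · exact hc.2.1 i (by simpa using hi)
    · rfl
  · have h := congrArg (LinearMap.baseChange ℚ (LinearMap.inl ℤ N ℤ)) hc.2.2
    simpa [bar, bundle] using h

theorem fibrePoly_mem (X : ExtStackyFan N ι κ) (j : ι ⊕ κ) (v : N)
    (f : MvPolynomial (ι ⊕ Fin 2) ℚ) (hf : f ∈ (X.bundle j).sectorIdeal (v, 0)) :
    fibrePoly f ∈ X.sectorIdeal v := by
  suffices h : (X.bundle j).sectorIdeal (v, 0) ≤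
      (X.sectorIdeal v).comap (fibrePoly (ι := ι)) from h hf
  rw [sectorIdeal, Ideal.span_le]
  rintro f (⟨θ, rfl⟩ | ⟨J, hJ, rfl⟩)
  · refine Ideal.subset_span (Or.inl ⟨θ.comp (AddMonoidHom.inl N ℤ), ?_⟩)
    simp [fibrePoly, bundle]
  · by_cases h : ∃ i, Sum.inr i ∈ J
    · obtain ⟨i, hi⟩ := h
      have : fibrePoly (∏ i ∈ J, MvPolynomial.X i : MvPolynomial (ι ⊕ Fin 2) ℚ) = 0 := by
        rw [map_prod]
        exact Finset.prod_eq_zero hi (by simp [fibrePoly])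
      simp [this]
    · push Not at h
      classical
      obtain ⟨J', rfl⟩ : ∃ J' : Finset ι, J = J'.map Function.Embedding.inl := by
        refine ⟨Finset.univ.filter fun i => Sum.inl i ∈ J, ?_⟩
        ext (i | i)
        · simp
        · simp [h i]
      refine Ideal.subset_span (Or.inr ⟨J', ?_, by simp [fibrePoly]⟩)
      rintro ⟨τ, hτ, hJτ, c, hc⟩
      obtain ⟨h1, h2⟩ := X.boxRep_bundle j hτ hc
      exact hJ ⟨_, h1, Finset.map_subset_map.2 hJτ, _, h2⟩

/-- The pull-back `ι^* : H^*_orb(ℰ_j) → H^*_orb(𝒳)` along the inclusion of a fibre: the sector `v`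
of `𝒳` is included in the sector `(v, 0)` of `ℰ_j`. -/
def fibrePullback (X : ExtStackyFan N ι κ) (j : ι ⊕ κ) : (X.bundle j).Horb →+* X.Horb :=
  RingHom.pi fun v =>
    (Ideal.quotientMap (X.sectorIdeal v) (fibrePoly (ι := ι)).toRingHom
      (fun f hf => X.fibrePoly_mem j v f hf)).comp
    (Pi.evalRingHom (fun u : (X.bundle j).Box => (X.bundle j).SectorCoh u)
      ⟨((v : N), 0), by
        obtain ⟨τ, hτ, c, hc⟩ := v.2
        exact ⟨_, (X.boxRep_bundle j hτ hc).1, _, (X.boxRep_bundle j hτ hc).2⟩⟩)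

/-! ### The explicit formula -/

/-- `C_d = ∏_{⟨D_i, d⟩ < 0} ∏_{⟨D_i, d⟩ < k < 0} (⟨D_i, d⟩ - k) ·
∏_{⟨D_i, d⟩ > 0} ∏_{0 ≤ k < ⟨D_i, d⟩} (⟨D_i, d⟩ - k)⁻¹`, over integers `k`. -/
def Ccoef (X : ExtStackyFan N ι κ) (d : X.LQ) : ℚ :=
  ∏ i, ((∏ k ∈ Finset.Ioo ⌊X.pair (X.DS i) d⌋ 0, (X.pair (X.DS i) d - k)) *
    ∏ k ∈ Finset.Ico 0 ⌈X.pair (X.DS i) d⌉, (X.pair (X.DS i) d - k)⁻¹)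

/-- The `d` with `⟨ρ^S, d⟩ = 0`, `⟨D_i^S, d⟩ ∈ ℤ_{<0}` and `⟨D_k^S, d⟩ ∈ ℤ_{≥0}` for `k ≠ i`. -/
def untwistedSet (X : ExtStackyFan N ι κ) (i : ι) : Set X.LQ :=
  {d | X.pair X.rhoS d = 0 ∧ (∃ n : ℤ, n < 0 ∧ X.pair (X.DS (Sum.inl i)) d = n) ∧
    ∀ k, k ≠ Sum.inl i → ∃ n : ℕ, X.pair (X.DS k) d = n}

/-- The `d ∈ 𝕂_eff` with `∑ ⌈⟨D_i^S, d⟩⌉ = 1` and no `⟨D_i^S, d⟩` a negative integer. -/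
def twistedSet (X : ExtStackyFan N ι κ) : Set X.LQ :=
  {d | d ∈ X.Keff ∧ ∑ i, ⌈X.pair (X.DS i) d⌉ = 1 ∧
    ∀ i, ¬ ∃ n : ℤ, n < 0 ∧ X.pair (X.DS i) d = n}

open Classical in
/-- A constant, as a formal series. -/
def constSeries {V A : Type*} [Zero A] (x : A) : (V → ℚ) → A := fun e => if e = 0 then x else 0

end ExtStackyFan

end

open scoped TensorProduct

noncomputable section

/-! ### Leading terms of hypergeometric factors -/

section Laurent

variable {H H' : Type*} [CommRing H] [CommRing H']

/-! Put w = z⁻¹. The hypergeometric factor of D at a starts with a rational constant times w^⌈a⌉, or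
times D w^(⌈a⌉+1) if a is a negative integer, because then the factor k = a is D itself
(`hasLeadingForm_hyperFactor`). Multiplying over all i, the term of d starts at w^(S + n) with
coefficient C_d ∏ D_i, where S = ∑⌈⟨D_i^S, d⟩⌉ and i runs over the n indices with a negative
integral pairing (`hasLeadingForm_hyperTerm`).

As ρ^S lies in the closure of the Kähler cone, ⟨ρ^S, d⟩ ≥ 0 on 𝕂_eff, hence S ≥ 0. The exponent S +
n is 0 only for d = 0. It is 1 only for S = 0, n = 1 (the first sum; an extended index gives D_i =
0) or S = 1, n = 0 (the second sum). This computes the coefficient of w (`hyperTerm_coeff_one`).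

The operator ∑ m_{ja} y_a ∂/∂y_a multiplies y^d by ⟨D_j^S, d⟩ and turns ∑ p_a log y_a into D_j. The
coefficient of y^d in the Batyrev element is therefore the w⁰ coefficient of (D_j + ⟨D_j^S, d⟩ z)
times the term of d, multiplied by the sector unit (`batyrev_apply`). The explicit formula follows.

On ℰ_j, the part linear in y_0 comes from the classes (d, 1). There the pairing with D_j drops by
one, which multiplies the factor of D_j by exactly D_j + ⟨D_j^S, d⟩ z (`hyperFactor_sub_one`). The
two fibre divisors restrict to 0 and contribute w each. So the w² coefficient restricts to the w⁰
coefficient above (`laurentMap_hyperTerm`). If d is effective but (d, 1) is not, the corresponding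
term on 𝒳 vanishes (`coeff_linFactor_mul_hyperTerm_eq_zero`). -/

theorem ringInverse_eq_of_mul_eq_one {x y : H} (h : x * y = 1) : Ring.inverse x = y := by
  rw [← mul_one (Ring.inverse x), ← h,
    Ring.inverse_mul_cancel_left _ _ (IsUnit.of_mul_eq_one _ h)]

/-- The ring homomorphism of Laurent series induced by a homomorphism of coefficient rings. -/
def laurentMap (f : H →+* H') : LaurentSeries H →+* LaurentSeries H' where
  toFun x := HahnSeries.map x f
  map_one' := HahnSeries.map_one (f.toMonoidWithZeroHom)
  map_mul' x y := HahnSeries.map_mul (f : H →ₙ+* H') (x := x) (y := y)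
  map_zero' := HahnSeries.map_zero (f : ZeroHom H H')
  map_add' x y := HahnSeries.map_add (f : H →+ H') (x := x) (y := y)

@[simp]
theorem laurentMap_coeff (f : H →+* H') (x : LaurentSeries H) (n : ℤ) :
    (laurentMap f x).coeff n = f (x.coeff n) := rfl

@[simp]
theorem laurentMap_C (f : H →+* H') (x : H) :
    laurentMap f (HahnSeries.C x) = HahnSeries.C (f x) := HahnSeries.map_C x f

@[simp]
theorem laurentMap_single (f : H →+* H') (n : ℤ) (x : H) :
    laurentMap f (HahnSeries.single n x) = HahnSeries.single n (f x) :=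
  HahnSeries.map_single (f : ZeroHom H H')

variable [Algebra ℚ H] [Algebra ℚ H']

/-- The Laurent series `f` in `w` is `E w ^ M (c + O(w))`. -/
def HasLeadingForm (f : LaurentSeries H) (E : H) (M : ℤ) (c : ℚ) : Prop :=
  ∃ Q : PowerSeries H, PowerSeries.constantCoeff Q = algebraMap ℚ H c ∧
    f = HahnSeries.C E * HahnSeries.single M 1 * HahnSeries.ofPowerSeries ℤ H Q

namespace HasLeadingForm

theorem one : HasLeadingForm (1 : LaurentSeries H) 1 0 1 :=
  ⟨1, by simp, by simp⟩

theorem mul {f g : LaurentSeries H} {E E' : H} {M M' : ℤ} {c c' : ℚ}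
    (hf : HasLeadingForm f E M c) (hg : HasLeadingForm g E' M' c') :
    HasLeadingForm (f * g) (E * E') (M + M') (c * c') := by
  obtain ⟨Q, hQ, rfl⟩ := hf
  obtain ⟨R, hR, rfl⟩ := hg
  refine ⟨Q * R, by simp [hQ, hR], ?_⟩
  have : (HahnSeries.single (M + M') (1 : H)) =
      HahnSeries.single M 1 * HahnSeries.single M' 1 := by
    rw [HahnSeries.single_mul_single, one_mul]
  rw [map_mul, map_mul, this]
  ring

theorem prod {α : Type*} (s : Finset α) {f : α → LaurentSeries H} {E : α → H} {M : α → ℤ}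
    {c : α → ℚ} (h : ∀ i ∈ s, HasLeadingForm (f i) (E i) (M i) (c i)) :
    HasLeadingForm (∏ i ∈ s, f i) (∏ i ∈ s, E i) (∑ i ∈ s, M i) (∏ i ∈ s, c i) := by
  classical
  induction s using Finset.induction_on with
  | empty => simpa using one
  | insert a s ha ih =>
    simp only [Finset.prod_insert ha, Finset.sum_insert ha]
    exact (h a (by simp)).mul (ih fun i hi => h i (by simp [hi]))

/-- With E = 1 the power series part has the unit c as constant coefficient, so it is invertible. -/
theorem exists_mul_eq_one {f : LaurentSeries H} {M : ℤ} {c : ℚ} (hf : HasLeadingForm f 1 M c)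
    (hc : c ≠ 0) : ∃ g, f * g = 1 ∧ HasLeadingForm g 1 (-M) c⁻¹ := by
  obtain ⟨Q, hQ, rfl⟩ := hf
  have hu : IsUnit Q := PowerSeries.isUnit_iff_constantCoeff.2 (by
    rw [hQ]; exact (isUnit_iff_ne_zero.2 hc).map _)
  obtain ⟨u, rfl⟩ := hu
  have h1 : (u : PowerSeries H) * ↑u⁻¹ = 1 := by simp
  refine ⟨HahnSeries.single (-M) 1 * HahnSeries.ofPowerSeries ℤ H (↑u⁻¹ : PowerSeries H), ?_,
    ⟨↑u⁻¹, ?_, by simp⟩⟩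
  · have h2 : HahnSeries.single M (1 : H) * HahnSeries.single (-M) (1 : H) = 1 := by
      rw [HahnSeries.single_mul_single, one_mul, add_neg_cancel]; rfl
    have h3 := congrArg (HahnSeries.ofPowerSeries ℤ H) h1
    rw [map_mul, map_one] at h3
    rw [map_one, one_mul]
    calc _ = (HahnSeries.single M (1 : H) * HahnSeries.single (-M) (1 : H)) *
        (HahnSeries.ofPowerSeries ℤ H ↑u * HahnSeries.ofPowerSeries ℤ H ↑u⁻¹) := by ring
      _ = 1 := by rw [h2, h3, one_mul]
  · have h3 := congrArg PowerSeries.constantCoeff h1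
    rw [map_mul, map_one, hQ] at h3
    calc PowerSeries.constantCoeff (↑u⁻¹ : PowerSeries H)
        = algebraMap ℚ H (c⁻¹ * c) * PowerSeries.constantCoeff (↑u⁻¹ : PowerSeries H) := by
          rw [inv_mul_cancel₀ hc, map_one, one_mul]
      _ = algebraMap ℚ H c⁻¹ := by rw [map_mul, mul_assoc, h3, mul_one]

theorem isUnit {f : LaurentSeries H} {M : ℤ} {c : ℚ} (hf : HasLeadingForm f 1 M c)
    (hc : c ≠ 0) : IsUnit f := by
  obtain ⟨g, hg, -⟩ := hf.exists_mul_eq_one hc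
  exact IsUnit.of_mul_eq_one _ hg

theorem inverse {f : LaurentSeries H} {M : ℤ} {c : ℚ} (hf : HasLeadingForm f 1 M c)
    (hc : c ≠ 0) : HasLeadingForm (Ring.inverse f) 1 (-M) c⁻¹ := by
  obtain ⟨g, hg, h⟩ := hf.exists_mul_eq_one hc
  rwa [ringInverse_eq_of_mul_eq_one hg]

theorem coeff_of_lt {f : LaurentSeries H} {E : H} {M : ℤ} {c : ℚ} (hf : HasLeadingForm f E M c)
    {n : ℤ} (hn : n < M) : f.coeff n = 0 := by
  obtain ⟨Q, hQ, rfl⟩ := hf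
  rw [mul_assoc, HahnSeries.C_apply, HahnSeries.coeff_single_mul, HahnSeries.coeff_single_mul,
    PowerSeries.coeff_coe, if_pos (by omega)]
  simp

theorem coeff_self {f : LaurentSeries H} {E : H} {M : ℤ} {c : ℚ}
    (hf : HasLeadingForm f E M c) : f.coeff M = c • E := by
  obtain ⟨Q, hQ, rfl⟩ := hf
  rw [mul_assoc, HahnSeries.C_apply, HahnSeries.coeff_single_mul, HahnSeries.coeff_single_mul,
    PowerSeries.coeff_coe, if_neg (by omega)]
  simp [hQ, Algebra.smul_def, mul_comm]

end HasLeadingForm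

theorem hasLeadingForm_linFactor (D : H) (c : ℚ) : HasLeadingForm (linFactor D c) 1 (-1) c := by
  refine ⟨PowerSeries.C (algebraMap ℚ H c) + PowerSeries.C D * PowerSeries.X, by simp, ?_⟩
  simp only [linFactor, map_add, map_mul, HahnSeries.ofPowerSeries_C, HahnSeries.ofPowerSeries_X,
    HahnSeries.C_apply, mul_add, HahnSeries.single_mul_single]
  simp [add_comm]

theorem linFactor_zero (D : H) : linFactor D 0 = HahnSeries.C D := by simp [linFactor]

theorem hasLeadingForm_C (D : H) : HasLeadingForm (HahnSeries.C D : LaurentSeries H) D 0 1 :=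
  ⟨1, by simp, by simp⟩

theorem isUnit_linFactor (D : H) {c : ℚ} (hc : c ≠ 0) : IsUnit (linFactor D c) :=
  (hasLeadingForm_linFactor D c).isUnit hc

theorem sub_ne_zero_of_mem_Ico {a : ℚ} {k : ℤ} (hk : k ∈ Finset.Ico 0 ⌈a⌉) : a - k ≠ 0 := by
  have := Int.lt_ceil.1 (Finset.mem_Ico.1 hk).2
  exact (sub_pos.2 this).ne'

theorem isUnit_prod_linFactor (D : H) (a : ℚ) :
    IsUnit (∏ k ∈ Finset.Ico 0 ⌈a⌉, linFactor D (a - k)) := by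
  have h := HasLeadingForm.prod (Finset.Ico 0 ⌈a⌉)
    (fun k _ => hasLeadingForm_linFactor D (a - k))
  rw [Finset.prod_const_one] at h
  exact h.isUnit (Finset.prod_ne_zero_iff.2 fun k hk => sub_ne_zero_of_mem_Ico hk)

open Classical in
/-- The hypergeometric factor of `D` at `a` begins with `w ^ ⌈a⌉`, unless `a` is a negative integer,
when it begins with `D w ^ (⌈a⌉ + 1)`. -/
theorem hasLeadingForm_hyperFactor (D : H) (a : ℚ) :
    HasLeadingForm (hyperFactor D a) (if ∃ n : ℤ, n < 0 ∧ a = n then D else 1)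
      (⌈a⌉ + if ∃ n : ℤ, n < 0 ∧ a = n then 1 else 0)
      ((∏ k ∈ Finset.Ioo ⌊a⌋ 0, (a - k)) * ∏ k ∈ Finset.Ico 0 ⌈a⌉, (a - k)⁻¹) := by
  split_ifs with h
  · obtain ⟨n, hn, rfl⟩ := h
    -- The factor k = n is split off: its z-part vanishes and it contributes D. This is the origin
    -- of the extra power of w and of the open interval in C_d.
    rw [hyperFactor, Int.ceil_intCast, Int.floor_intCast, Finset.Ico_eq_empty_of_le hn.le,
      ← Finset.Ioo_insert_left hn, Finset.prod_insert (by simp), Finset.prod_empty,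
      Finset.prod_empty, Ring.inverse_one, mul_one, mul_one, sub_self, linFactor_zero]
    have h := (hasLeadingForm_C D).mul (HasLeadingForm.prod (Finset.Ioo n 0)
      (fun k _ => hasLeadingForm_linFactor D (n - k)))
    rw [Finset.prod_const_one, Finset.sum_const, Int.card_Ioo, mul_one, one_mul] at h
    convert h using 1
    simp
    omega
  · have h1 := HasLeadingForm.prod (Finset.Ico ⌈a⌉ 0)
      (fun k _ => hasLeadingForm_linFactor D (a - k))
    have h2 := HasLeadingForm.prod (Finset.Ico 0 ⌈a⌉)
      (fun k _ => hasLeadingForm_linFactor D (a - k))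
    rw [Finset.prod_const_one] at h1 h2
    have h3 := h1.mul
      (h2.inverse (Finset.prod_ne_zero_iff.2 fun k hk => sub_ne_zero_of_mem_Ico hk))
    -- The two ranges could differ only at k = a < 0, which is excluded in this case.
    have h4 : Finset.Ioo ⌊a⌋ 0 = Finset.Ico ⌈a⌉ 0 := by
      ext k
      simp only [Finset.mem_Ioo, Finset.mem_Ico, and_congr_left_iff]
      intro hk
      rw [Int.floor_lt, Int.ceil_le, lt_iff_le_and_ne, and_iff_left_iff_imp]
      exact fun _ h5 => h ⟨k, hk, h5⟩
    rw [hyperFactor, h4, Finset.prod_inv_distrib]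
    convert h3 using 1
    · rw [mul_one]
    · simp only [Finset.sum_const, Int.card_Ico]
      simp
      omega

theorem hyperFactor_zero (D : H) : hyperFactor D 0 = 1 := by simp [hyperFactor]

/-- This is 1/z = w, the contribution of each fibre divisor once restricted to a fibre. -/
theorem hyperFactor_one_zero :
    hyperFactor (0 : H) 1 = HahnSeries.single 1 1 := by
  have h : linFactor (0 : H) 1 * HahnSeries.single 1 1 = 1 := by
    simp only [linFactor, map_zero, zero_add, map_one, HahnSeries.single_mul_single]
    simp
  have h2 : hyperFactor (0 : H) 1 = Ring.inverse (linFactor (0 : H) 1) := by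
    have : Finset.Ico (0 : ℤ) 1 = {0} := by decide
    simp [hyperFactor, this]
  rw [h2, ringInverse_eq_of_mul_eq_one h]

/-- Lowering a by one shifts the index k. Compared with the factor at a, the term k = 0, which is D
+ az, is either gained by the numerator (⌈a⌉ ≤ 0) or lost by the denominator (⌈a⌉ > 0). -/
theorem hyperFactor_sub_one (D : H) (a : ℚ) :
    hyperFactor D (a - 1) = linFactor D a * hyperFactor D a := by
  have hs : ∀ s t : ℤ, ∏ k ∈ Finset.Ico s t, linFactor D (a - 1 - k) =
      ∏ k ∈ Finset.Ico (s + 1) (t + 1), linFactor D (a - k) := by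
    intro s t
    rw [← Finset.prod_Ico_add' (fun k : ℤ => linFactor D (a - k))]
    refine Finset.prod_congr rfl fun k _ => ?_
    congr 1
    push_cast
    ring
  have hc : ⌈a - 1⌉ = ⌈a⌉ - 1 := Int.ceil_sub_one a
  simp only [hyperFactor, hc]
  rw [hs, hs, sub_add_cancel, zero_add]
  rcases le_or_gt ⌈a⌉ 0 with h | h
  · rw [Finset.Ico_eq_empty_of_le h, Finset.Ico_eq_empty_of_le (by omega : ⌈a⌉ ≤ 1)]
    have : Finset.Ico ⌈a⌉ 1 = insert 0 (Finset.Ico ⌈a⌉ 0) := by ext; simp; omega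
    rw [this, Finset.prod_insert (by simp)]
    simp
  · rw [Finset.Ico_eq_empty_of_le h.le, Finset.Ico_eq_empty_of_le (by omega : 1 ≤ ⌈a⌉)]
    have : Finset.Ico 0 ⌈a⌉ = insert 0 (Finset.Ico 1 ⌈a⌉) := by ext; simp; omega
    have hu : IsUnit (linFactor D a) := isUnit_linFactor D (Int.ceil_pos.1 h).ne'
    rw [this, Finset.prod_insert (by simp), Int.cast_zero, sub_zero,
      mul_comm (linFactor D a) (∏ k ∈ _, _),
      Ring.inverse_mul (Or.inr hu)]
    simp only [Finset.prod_empty, one_mul]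
    rw [Ring.mul_inverse_cancel_left _ _ hu]

theorem laurentMap_linFactor (f : H →+* H') (D : H) (c : ℚ) :
    laurentMap f (linFactor D c) = linFactor (f D) c := by
  simp [linFactor]

/-- `Ring.inverse` commutes with a ring homomorphism here because the denominator is a unit. -/
theorem laurentMap_hyperFactor (f : H →+* H') (D : H) (a : ℚ) :
    laurentMap f (hyperFactor D a) = hyperFactor (f D) a := by
  have h1 := congrArg (laurentMap f) (Ring.mul_inverse_cancel _ (isUnit_prod_linFactor D a))
  simp only [map_mul, map_prod, laurentMap_linFactor, map_one] at h1
  simp only [hyperFactor, map_mul, map_prod, laurentMap_linFactor]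
  congr 1
  rw [ringInverse_eq_of_mul_eq_one h1]

/-- The coefficients of `(D + a z) T`. -/
theorem coeff_linFactor_mul (D : H) (a : ℚ) (T : LaurentSeries H) (n : ℤ) :
    (linFactor D a * T).coeff n = D * T.coeff n + algebraMap ℚ H a * T.coeff (n + 1) := by
  rw [linFactor, add_mul, HahnSeries.coeff_add, HahnSeries.C_apply, HahnSeries.coeff_single_mul,
    HahnSeries.coeff_single_mul]
  simp

end Laurent

/-! ### The pairing, and the classes of linear forms -/

/-- A common denominator exists, so identities on 𝕃^S ⊗ ℚ can be checked on lattice vectors divided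
by n. -/
theorem exists_eq_inv_tmul {M : Type*} [AddCommGroup M] (d : ℚ ⊗[ℤ] M) :
    ∃ n : ℕ, 0 < n ∧ ∃ x : M, d = (n : ℚ)⁻¹ ⊗ₜ[ℤ] x := by
  induction d using TensorProduct.induction_on with
  | zero => exact ⟨1, one_pos, 0, by simp⟩
  | tmul q y =>
    refine ⟨q.den, q.pos, q.num • y, ?_⟩
    rw [← TensorProduct.smul_tmul, zsmul_eq_mul, ← div_eq_mul_inv, Rat.num_div_den]
  | add a b ha hb =>
    obtain ⟨n, hn, x, rfl⟩ := ha
    obtain ⟨k, hk, y, rfl⟩ := hb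
    refine ⟨n * k, Nat.mul_pos hn hk, (k : ℤ) • x + (n : ℤ) • y, ?_⟩
    have hn' : (n : ℚ) ≠ 0 := by positivity
    have hk' : (k : ℚ) ≠ 0 := by positivity
    rw [TensorProduct.tmul_add, ← TensorProduct.smul_tmul, ← TensorProduct.smul_tmul]
    congr 2
    · rw [zsmul_eq_mul]; push_cast; field_simp
    · rw [zsmul_eq_mul]; push_cast; field_simp

namespace ExtStackyFan

variable {N : Type*} [AddCommGroup N] {ι κ : Type*} [Fintype ι] [Fintype κ]
variable (X : ExtStackyFan N ι κ)

@[simp]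
theorem pair_tmul (f : Module.Dual ℤ X.L) (q : ℚ) (x : X.L) :
    X.pair f (q ⊗ₜ[ℤ] x) = f x * q := by
  simp [pair]

theorem DS_apply (i : ι ⊕ κ) (x : X.L) : X.DS i x = (x : ι ⊕ κ → ℤ) i := rfl

theorem pair_sum_smul {α : Type*} (s : Finset α) (c : α → ℤ) (f : α → Module.Dual ℤ X.L)
    (d : X.LQ) : X.pair (∑ a ∈ s, c a • f a) d = ∑ a ∈ s, (c a : ℚ) * X.pair (f a) d := by
  obtain ⟨n, -, x, rfl⟩ := exists_eq_inv_tmul d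
  simp [LinearMap.sum_apply, Finset.sum_mul, mul_assoc]

theorem pair_rhoS (d : X.LQ) : X.pair X.rhoS d = ∑ i, X.pair (X.DS i) d := by
  simpa [rhoS] using X.pair_sum_smul Finset.univ (fun _ => 1) X.DS d

theorem eq_zero_of_pair_DS {d : X.LQ} (h : ∀ i, X.pair (X.DS i) d = 0) : d = 0 := by
  obtain ⟨n, hn, x, rfl⟩ := exists_eq_inv_tmul d
  have : x = 0 := by
    ext i
    have := h i
    rw [pair_tmul, DS_apply] at this
    have hn' : (n : ℚ)⁻¹ ≠ 0 := by positivity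
    simpa [hn'] using this
  simp [this]

theorem ext_pair_DS {d d' : X.LQ} (h : ∀ i, X.pair (X.DS i) d = X.pair (X.DS i) d') : d = d' :=
  sub_eq_zero.1 (X.eq_zero_of_pair_DS fun i => by rw [map_sub, h, sub_self])

/-- The pairing with an arbitrary form is determined by the pairings with a basis. -/
theorem pair_eq_sum_repr {α : Type*} [Fintype α] (p : Module.Basis α ℤ (Module.Dual ℤ X.L))
    (f : Module.Dual ℤ X.L) (d : X.LQ) :
    X.pair f d = ∑ a, (p.repr f a : ℚ) * X.pair (p a) d := by
  conv_lhs => rw [← p.sum_repr f]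
  exact X.pair_sum_smul _ _ _ d

theorem ext_pair_basis {α : Type*} [Fintype α] (p : Module.Basis α ℤ (Module.Dual ℤ X.L))
    {d d' : X.LQ} (h : ∀ a, X.pair (p a) d = X.pair (p a) d') : d = d' :=
  X.ext_pair_DS fun i => by
    rw [X.pair_eq_sum_repr p, X.pair_eq_sum_repr p (X.DS i) d']
    exact Finset.sum_congr rfl fun a _ => by rw [h a]

/-- The closure of the Kähler cone pairs non-negatively with `𝕂_eff`. -/
theorem pair_nonneg_of_mem_closure {f : Module.Dual ℤ X.L}
    (hf : X.toReal f ∈ closure X.kahlerCone) {d : X.LQ} (hd : d ∈ X.Keff) : 0 ≤ X.pair f d := by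
  obtain ⟨n, hn, x, rfl⟩ := exists_eq_inv_tmul d
  have hn' : (0 : ℚ) < (n : ℚ)⁻¹ := by positivity
  have hsub : X.kahlerCone ⊆ {g | 0 ≤ g x} := by
    intro g hg
    -- The anticone chosen is that of d itself: g is then a positive combination of forms that are
    -- non-negative on d. Non-negativity at x is a closed condition, so it passes to the closure.
    obtain ⟨a, ha, ha', rfl⟩ := hg _ hd
    simp only [Set.mem_ofPred_eq, Finset.sum_apply, Pi.smul_apply, smul_eq_mul]
    refine Finset.sum_nonneg fun i _ => ?_
    by_cases hi : ∃ k : ℕ, X.pair (X.DS i) ((n : ℚ)⁻¹ ⊗ₜ[ℤ] x) = k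
    · refine mul_nonneg (ha i hi).le ?_
      obtain ⟨k, hk⟩ := hi
      rw [pair_tmul] at hk
      have : 0 ≤ (X.DS i x : ℚ) :=
        nonneg_of_mul_nonneg_left (hk ▸ Nat.cast_nonneg k) hn'
      rw [toReal]
      exact_mod_cast this
    · simp [ha' i hi]
  have hcl : IsClosed {g : X.L → ℝ | 0 ≤ g x} :=
    isClosed_le continuous_const (continuous_apply x)
  have h : (0 : ℝ) ≤ X.toReal f x := closure_minimal hsub hcl hf
  rw [pair_tmul]
  refine mul_nonneg ?_ hn'.le
  rw [toReal] at h
  exact_mod_cast h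

/-- When all pairings are integers z_i, n ∑ z_i b_i is the image under β^S of a kernel element, so ∑
z_i b_i is torsion. -/
theorem red_eq_zero [IsAddTorsionFree N] {d : X.LQ}
    (hd : ∀ i, ∃ n : ℤ, X.pair (X.DS i) d = n) : X.red d = 0 := by
  obtain ⟨n, hn, x, rfl⟩ := exists_eq_inv_tmul d
  choose z hz using hd
  have hx : ∀ i, (x : ι ⊕ κ → ℤ) i = n * z i := by
    intro i
    have := hz i
    rw [pair_tmul, DS_apply] at this
    have hn' : (n : ℚ) ≠ 0 := by positivity
    field_simp at this
    exact_mod_cast this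
  have hk : X.betaS (x : ι ⊕ κ → ℤ) = 0 := x.2
  rw [betaS, Fintype.linearCombination_apply] at hk
  simp only [red, hz, Int.ceil_intCast]
  have : n • ∑ i, z i • X.vec i = 0 := by
    rw [← hk, Finset.smul_sum]
    refine Finset.sum_congr rfl fun i _ => ?_
    rw [hx, mul_smul, natCast_zsmul]
  exact (smul_eq_zero.1 this).resolve_left hn.ne'

set_option linter.unusedSectionVars false in
theorem smul_eq_algebraMap_mul (q : ℚ) (x : X.Horb) :
    q • x = algebraMap ℚ X.Horb q * x :=
  Algebra.smul_def q x

/-! ### Linear relations between divisor classes -/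

theorem betaS_surjective (hS : X.IsBoxExtension) : Function.Surjective X.betaS := by
  rw [← LinearMap.range_eq_top, betaS, Fintype.range_linearCombination]
  apply Submodule.toAddSubgroup_injective
  rw [Submodule.span_int_eq_addSubgroupClosure, hS.generates]
  rfl

/-- The linear relations between the forms `D_i^S` also hold between the divisor classes. -/
theorem sum_smul_divClass_eq_zero (hS : X.IsBoxExtension) {a : ι ⊕ κ → ℚ}
    (ha : ∀ d : X.L, ∑ i, a i * ((d : ι ⊕ κ → ℤ) i : ℚ) = 0) :
    ∑ i, a i • X.divClass i = 0 := by
  set n : ℕ := ∏ i, (a i).den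
  have hn : (n : ℚ) ≠ 0 := by
    have : n ≠ 0 := Finset.prod_ne_zero_iff.2 fun i _ => (a i).den_nz
    exact_mod_cast this
  have hA : ∀ i, ∃ z : ℤ, (z : ℚ) = n * a i := by
    intro i
    obtain ⟨k, hk⟩ : (a i).den ∣ n := Finset.dvd_prod_of_mem _ (Finset.mem_univ i)
    refine ⟨k * (a i).num, ?_⟩
    rw [hk]
    push_cast
    rw [← Rat.den_mul_eq_num]
    ring
  choose A hA using hA
  -- After clearing denominators the relation is an integral form vanishing on ker β^S. It descends
  -- to θ : N → ℤ with θ(b_i) = A_i, and θ gives one of the defining linear relations of every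
  -- sector.
  let φ : (ι ⊕ κ → ℤ) →ₗ[ℤ] ℤ := Fintype.linearCombination ℤ A
  have hφ : LinearMap.ker X.betaS ≤ LinearMap.ker φ := by
    intro d hd
    have h := ha ⟨d, hd⟩
    rw [LinearMap.mem_ker, Fintype.linearCombination_apply]
    have h2 : ((∑ i, d i • A i : ℤ) : ℚ) = 0 := by
      rw [← mul_zero (n : ℚ), ← h, Finset.mul_sum]
      push_cast
      refine Finset.sum_congr rfl fun i _ => ?_
      rw [zsmul_eq_mul]
      push_cast
      rw [hA]
      ring
    exact_mod_cast h2
  let θ : N →ₗ[ℤ] ℤ := (LinearMap.ker X.betaS).liftQ φ hφ ∘ₗ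
    (X.betaS.quotKerEquivOfSurjective (X.betaS_surjective hS)).symm.toLinearMap
  have hθ : ∀ i, θ (X.vec i) = A i := by
    classical
    intro i
    have h1 : X.betaS (Pi.single i 1) = X.vec i := by
      simp [betaS, Fintype.linearCombination_apply_single]
    have h2 : (X.betaS.quotKerEquivOfSurjective (X.betaS_surjective hS)).symm (X.vec i) =
        Submodule.Quotient.mk (Pi.single i 1) := by
      rw [LinearEquiv.symm_apply_eq, ← h1]
      rfl
    simp only [θ, LinearMap.comp_apply, LinearEquiv.coe_coe, h2, Submodule.liftQ_apply]
    simp [φ, Fintype.linearCombination_apply_single]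
  have key : (n : ℚ) • ∑ i, a i • X.divClass i = 0 := by
    funext v
    have h3 : Ideal.Quotient.mk (X.sectorIdeal v)
        (∑ i, MvPolynomial.C (θ (X.ray i) : ℚ) * MvPolynomial.X i) = 0 :=
      Ideal.Quotient.eq_zero_iff_mem.2
        (Ideal.subset_span (Or.inl ⟨θ.toAddMonoidHom, rfl⟩))
    rw [Pi.zero_apply, ← h3, Fintype.sum_sum_type]
    simp only [divClass, Sum.elim_inl, Sum.elim_inr, smul_zero, Finset.sum_const_zero, add_zero,
      Finset.smul_sum, Finset.sum_apply, map_sum, smul_smul, Pi.smul_apply]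
    refine Finset.sum_congr rfl fun i _ => ?_
    have h4 : θ (X.ray i) = A (Sum.inl i) := hθ (Sum.inl i)
    rw [h4, hA, ← MvPolynomial.smul_eq_C_mul]
    rfl
  rw [← one_smul ℚ (∑ i, a i • X.divClass i), ← inv_mul_cancel₀ hn]
  rw [smul_eq_algebraMap_mul] at key ⊢
  rw [map_mul, mul_assoc, key, mul_zero]

/-- Two expressions of f through the D_i^S differ by a linear relation, which also holds between the
divisor classes. -/
theorem cls_eq (hS : X.IsBoxExtension) {f : Module.Dual ℤ X.L} {a : ι ⊕ κ → ℚ}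
    (ha : ∀ d : X.L, (f d : ℚ) = ∑ i, a i * ((d : ι ⊕ κ → ℤ) i : ℚ)) :
    X.cls f = ∑ i, a i • X.divClass i := by
  have h := X.sum_smul_divClass_eq_zero hS (a := (X.exists_coeff f).choose - a) fun d => by
    simp only [Pi.sub_apply, sub_mul, Finset.sum_sub_distrib]
    rw [← ha, ← (X.exists_coeff f).choose_spec, sub_self]
  simp only [Pi.sub_apply, smul_eq_algebraMap_mul, map_sub, sub_mul, Finset.sum_sub_distrib] at h
  simpa only [cls, smul_eq_algebraMap_mul] using sub_eq_zero.1 h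

theorem cls_sum_smul (hS : X.IsBoxExtension) {α : Type*} (s : Finset α) (c : α → ℤ)
    (f : α → Module.Dual ℤ X.L) : X.cls (∑ a ∈ s, c a • f a) = ∑ a ∈ s, (c a : X.Horb) * X.cls (f a) := by
  rw [X.cls_eq hS (a := fun i => ∑ a ∈ s, c a • (X.exists_coeff (f a)).choose i)]
  · simp only [cls, smul_eq_algebraMap_mul, map_sum, Finset.sum_mul, Finset.mul_sum, zsmul_eq_mul,
      map_mul, map_intCast, mul_assoc]
    rw [Finset.sum_comm]
  · intro d
    simp only [LinearMap.sum_apply, LinearMap.smul_apply, Finset.sum_mul, Int.cast_sum]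
    rw [Finset.sum_comm]
    refine Finset.sum_congr rfl fun a _ => ?_
    rw [smul_eq_mul, Int.cast_mul, (X.exists_coeff (f a)).choose_spec, Finset.mul_sum]
    exact Finset.sum_congr rfl fun i _ => by rw [zsmul_eq_mul, mul_assoc]

theorem cls_DS (hS : X.IsBoxExtension) (j : ι ⊕ κ) : X.cls (X.DS j) = X.divClass j := by
  classical
  rw [X.cls_eq hS (a := Pi.single j 1)]
  · rw [Finset.sum_eq_single j] <;> simp +contextual [smul_eq_algebraMap_mul]
  · intro d
    rw [Finset.sum_eq_single j] <;> simp +contextual [DS_apply]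

/-- A form that is a real combination of the extended `D_i^S` has class zero. -/
theorem cls_eq_zero (hS : X.IsBoxExtension) {f : Module.Dual ℤ X.L} {c : κ → ℝ}
    (hc : X.toReal f = ∑ k, c k • X.toReal (X.DS (Sum.inr k))) : X.cls f = 0 := by
  -- A ℚ-linear retraction ℝ → ℚ makes the real coefficients rational without changing the integral
  -- values of f.
  obtain ⟨π, hπ⟩ := (Algebra.linearMap ℚ ℝ).exists_leftInverse_of_injective
    (LinearMap.ker_eq_bot.2 (algebraMap ℚ ℝ).injective)
  have hπ' : ∀ q : ℚ, π (q : ℝ) = q := fun q => by simpa using LinearMap.congr_fun hπ q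
  rw [X.cls_eq hS (a := Sum.elim 0 fun k => π (c k))]
  · simp [Fintype.sum_sum_type, divClass, smul_eq_algebraMap_mul]
  · intro d
    have h := congrFun hc d
    simp only [toReal, Finset.sum_apply, Pi.smul_apply, smul_eq_mul] at h
    have h2 := congrArg π h
    rw [map_sum] at h2
    have h3 : π ((f d : ℤ) : ℝ) = f d := by simpa using hπ' (f d)
    rw [h3] at h2
    rw [h2, Fintype.sum_sum_type]
    simp only [Sum.elim_inl, Sum.elim_inr, Pi.zero_apply, zero_mul, Finset.sum_const_zero,
      zero_add]
    refine Finset.sum_congr rfl fun k _ => ?_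
    rw [mul_comm, ← zsmul_eq_mul, map_zsmul, zsmul_eq_mul, mul_comm, DS_apply]

/-- The extended basis forms have class zero, so the variables occurring in the exponential
prefactor already recover all of D_j. -/
theorem sum_repr_smul_cls (hS : X.IsBoxExtension) {A B : Type*} [Fintype A] [Fintype B]
    (p : Module.Basis (A ⊕ B) ℤ (Module.Dual ℤ X.L)) (hp : ∀ b, X.cls (p (Sum.inr b)) = 0)
    (j : ι ⊕ κ) :
    ∑ a : A, (p.repr (X.DS j) (Sum.inl a) : X.Horb) * X.cls (p (Sum.inl a)) = X.divClass j := by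
  have h := X.cls_sum_smul hS Finset.univ (p.repr (X.DS j)) p
  rw [p.sum_repr, X.cls_DS hS, Fintype.sum_sum_type] at h
  simpa [hp] using h.symm

/-! ### Formal series -/

theorem monSum_eq {V : Type*} {p : V → Module.Dual ℤ X.L} {A : Type*} [AddCommMonoid A]
    {s : Set X.LQ} {c : X.LQ → A} {e : V → ℚ} {d : X.LQ}
    (hinj : ∀ d', (∀ a, X.pair (p a) d' = e a) → d' = d) (hd : d ∈ s)
    (he : ∀ a, X.pair (p a) d = e a) : X.monSum p s c e = c d := by
  classical
  rw [monSum, finsum_eq_single _ d]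
  · exact finsum_eq_if.trans (if_pos ⟨hd, he⟩)
  · intro d' hd'
    exact finsum_eq_if.trans (if_neg fun h => hd' (hinj d' h.2))

theorem monSum_eq_zero {V : Type*} {p : V → Module.Dual ℤ X.L} {A : Type*} [AddCommMonoid A]
    {s : Set X.LQ} {c : X.LQ → A} {e : V → ℚ}
    (h : ∀ d ∈ s, ¬ ∀ a, X.pair (p a) d = e a) : X.monSum p s c e = 0 := by
  classical
  rw [monSum, finsum_eq_zero_of_forall_eq_zero]
  exact fun d => finsum_eq_if.trans (if_neg fun h' => h d h'.1 h'.2)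

end ExtStackyFan

/-! ### The terms of the `I`-function -/

namespace ExtStackyFan

variable {N : Type*} [AddCommGroup N] {ι κ : Type*} [Fintype ι] [Fintype κ]
variable (X : ExtStackyFan N ι κ)

/-- The hypergeometric coefficient of `y^d 𝟏_{v(d)}`. -/
def hyperTerm (d : X.LQ) : LaurentSeries X.Horb :=
  ∏ i, hyperFactor (X.divClass i) (X.pair (X.DS i) d)

/-- `∑ ⌈⟨D_i^S, d⟩⌉`. -/
def ceilSum (d : X.LQ) : ℤ := ∑ i, ⌈X.pair (X.DS i) d⌉

open Classical in
/-- The indices for which `⟨D_i^S, d⟩` is a negative integer. -/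
def negSet (d : X.LQ) : Finset (ι ⊕ κ) :=
  Finset.univ.filter fun i => ∃ n : ℤ, n < 0 ∧ X.pair (X.DS i) d = n

theorem mem_negSet {d : X.LQ} {i : ι ⊕ κ} :
    i ∈ X.negSet d ↔ ∃ n : ℤ, n < 0 ∧ X.pair (X.DS i) d = n := by
  simp [negSet]

/-- Leading forms multiply; each negative integral pairing adds one divisor class and one power of
w. -/
theorem hasLeadingForm_hyperTerm (d : X.LQ) :
    HasLeadingForm (X.hyperTerm d) (∏ i ∈ X.negSet d, X.divClass i)
      (X.ceilSum d + (X.negSet d).card) (X.Ccoef d) := by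
  classical
  have h := HasLeadingForm.prod Finset.univ
    (fun i _ => hasLeadingForm_hyperFactor (X.divClass i) (X.pair (X.DS i) d))
  rw [Finset.sum_add_distrib, Finset.sum_boole, ← Finset.prod_filter] at h
  exact h

theorem zero_mem_Keff (hX : X.IsCompleteSimplicial) : (0 : X.LQ) ∈ X.Keff := by
  obtain ⟨τ, hτ, -⟩ := hX.complete 0
  exact ⟨fun k => ⟨0, by simp⟩, ∅, hX.face τ hτ ∅ (by simp), fun i => by
    simpa using ⟨0, by simp⟩⟩

theorem ceilSum_nonneg {d : X.LQ} (hρ : 0 ≤ X.pair X.rhoS d) : 0 ≤ X.ceilSum d := by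
  have h : X.pair X.rhoS d ≤ (X.ceilSum d : ℚ) := by
    rw [pair_rhoS, ceilSum, Int.cast_sum]
    exact Finset.sum_le_sum fun i _ => Int.le_ceil _
  exact_mod_cast hρ.trans h

/-- The pairings sum to at least 0 and their ceilings to 0, so no rounding can take place. -/
theorem pair_eq_ceil {d : X.LQ} (hρ : 0 ≤ X.pair X.rhoS d) (hd : X.ceilSum d = 0)
    (i : ι ⊕ κ) : X.pair (X.DS i) d = ⌈X.pair (X.DS i) d⌉ := by
  have h1 : ∀ i ∈ Finset.univ, X.pair (X.DS i) d ≤ (⌈X.pair (X.DS i) d⌉ : ℚ) :=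
    fun i _ => Int.le_ceil _
  have h2 : ∑ i, (⌈X.pair (X.DS i) d⌉ : ℚ) = 0 := by
    rw [← Int.cast_sum]; exact_mod_cast hd
  refine (Finset.sum_eq_sum_iff_of_le h1).1 (le_antisymm (Finset.sum_le_sum h1) ?_) i
    (Finset.mem_univ i)
  rw [h2, ← pair_rhoS]
  exact hρ

theorem eq_zero_of_ceilSum_eq_zero {d : X.LQ} (hρ : 0 ≤ X.pair X.rhoS d)
    (hd : X.ceilSum d = 0) (hn : X.negSet d = ∅) : d = 0 := by
  have h0 : ∀ i, 0 ≤ ⌈X.pair (X.DS i) d⌉ := by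
    intro i
    by_contra h
    have : i ∈ X.negSet d := X.mem_negSet.2 ⟨_, not_le.1 h, X.pair_eq_ceil hρ hd i⟩
    simp [hn] at this
  have h1 := (Finset.sum_eq_zero_iff_of_nonneg fun i _ => h0 i).1 hd
  exact X.eq_zero_of_pair_DS fun i => by
    rw [X.pair_eq_ceil hρ hd, h1 i (Finset.mem_univ i), Int.cast_zero]

theorem hyperTerm_zero : X.hyperTerm 0 = 1 := by
  simp [hyperTerm, hyperFactor_zero]

theorem mem_untwistedSet_iff {d : X.LQ} (hρ : 0 ≤ X.pair X.rhoS d) (i : ι) :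
    d ∈ X.untwistedSet i ↔ X.ceilSum d = 0 ∧ X.negSet d = {Sum.inl i} := by
  constructor
  · rintro ⟨h1, ⟨n, hn, h2⟩, h3⟩
    have hint : ∀ k, (⌈X.pair (X.DS k) d⌉ : ℚ) = X.pair (X.DS k) d := by
      intro k
      by_cases hk : k = Sum.inl i
      · rw [hk, h2, Int.ceil_intCast]
      · obtain ⟨l, hl⟩ := h3 k hk
        rw [hl, Int.ceil_natCast, Int.cast_natCast]
    constructor
    · have : (X.ceilSum d : ℚ) = 0 := by
        rw [← h1, pair_rhoS, ceilSum, Int.cast_sum]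
        exact Finset.sum_congr rfl fun k _ => hint k
      exact_mod_cast this
    · ext k
      rw [mem_negSet, Finset.mem_singleton]
      constructor
      · rintro ⟨z, hz, hk⟩
        by_contra hne
        obtain ⟨l, hl⟩ := h3 k hne
        rw [hl] at hk
        have : (l : ℤ) = z := by exact_mod_cast hk
        omega
      · rintro rfl
        exact ⟨n, hn, h2⟩
  · rintro ⟨h1, h2⟩
    refine ⟨?_, X.mem_negSet.1 (by simp [h2]), fun k hk => ?_⟩
    · rw [pair_rhoS, Finset.sum_congr rfl fun i _ => X.pair_eq_ceil hρ h1 i, ← Int.cast_sum]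
      exact_mod_cast h1
    · have h3 := X.pair_eq_ceil hρ h1 k
      have h4 : 0 ≤ ⌈X.pair (X.DS k) d⌉ := by
        by_contra h
        have : k ∈ X.negSet d := X.mem_negSet.2 ⟨_, not_le.1 h, h3⟩
        rw [h2, Finset.mem_singleton] at this
        exact hk this
      obtain ⟨n, hn⟩ := Int.eq_ofNat_of_zero_le h4
      refine ⟨n, ?_⟩
      rw [h3, hn, Int.cast_natCast]

theorem mem_twistedSet_iff {d : X.LQ} (hd : d ∈ X.Keff) :
    d ∈ X.twistedSet ↔ X.ceilSum d = 1 ∧ X.negSet d = ∅ := by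
  rw [Finset.eq_empty_iff_forall_notMem]
  simp only [mem_negSet]
  exact ⟨fun h => ⟨h.2.1, h.2.2⟩, fun h => ⟨hd, h.1, h.2⟩⟩

theorem mem_Keff_of_mem_untwistedSet (hX : X.IsCompleteSimplicial) {d : X.LQ} {i : ι}
    (hd : d ∈ X.untwistedSet i) : d ∈ X.Keff := by
  obtain ⟨-, ⟨n, hn, h2⟩, h3⟩ := hd
  refine ⟨fun k => h3 _ (by simp), {i}, hX.ray_mem i, fun k => ?_⟩
  rw [Finset.mem_singleton]
  constructor
  · rintro rfl ⟨l, hl⟩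
    rw [h2] at hl
    have : n = (l : ℤ) := by exact_mod_cast hl
    omega
  · intro h
    by_contra hk
    exact h (h3 _ (by simpa using hk))

theorem hyperTerm_coeff_of_neg {d : X.LQ} (hρ : 0 ≤ X.pair X.rhoS d) {n : ℤ} (hn : n < 0) :
    (X.hyperTerm d).coeff n = 0 :=
  (X.hasLeadingForm_hyperTerm d).coeff_of_lt (by have := X.ceilSum_nonneg hρ; omega)

/-- Leading exponent 0 forces both non-negative summands to vanish: the pairings are then
non-negative integers with sum 0. -/
theorem hyperTerm_coeff_zero {d : X.LQ} (hρ : 0 ≤ X.pair X.rhoS d) (hd : d ≠ 0) :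
    (X.hyperTerm d).coeff 0 = 0 := by
  refine (X.hasLeadingForm_hyperTerm d).coeff_of_lt ?_
  have h := X.ceilSum_nonneg hρ
  by_contra hM
  exact hd (X.eq_zero_of_ceilSum_eq_zero hρ (by omega) (Finset.card_eq_zero.1 (by omega)))

open Classical in
/-- The coefficient of `z⁻¹` of the term of `d`. -/
theorem hyperTerm_coeff_one {d : X.LQ} (hd : d ∈ X.Keff) (hρ : 0 ≤ X.pair X.rhoS d) :
    (X.hyperTerm d).coeff 1 =
      ∑ i, (if d ∈ X.untwistedSet i then
        algebraMap ℚ X.Horb (X.Ccoef d) * X.divClass (Sum.inl i) else 0) +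
      if d ∈ X.twistedSet then algebraMap ℚ X.Horb (X.Ccoef d) else 0 := by
  have hS := X.ceilSum_nonneg hρ
  have hl := X.hasLeadingForm_hyperTerm d
  simp only [X.mem_untwistedSet_iff hρ, X.mem_twistedSet_iff hd]
  rcases Nat.lt_or_ge 1 (X.negSet d).card with hc | hc
  · rw [hl.coeff_of_lt (by omega), Finset.sum_eq_zero, if_neg, add_zero]
    · rintro ⟨-, h⟩
      simp [h] at hc
    · refine fun i _ => if_neg ?_
      rintro ⟨-, h⟩
      simp [h] at hc
  rcases Nat.le_one_iff_eq_zero_or_eq_one.1 hc with hc | hc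
  · rw [Finset.card_eq_zero] at hc
    rw [Finset.sum_eq_zero (fun i _ => if_neg (by simp [hc])), zero_add]
    by_cases h1 : X.ceilSum d = 1
    · rw [if_pos ⟨h1, hc⟩]
      have h2 : X.ceilSum d + (X.negSet d).card = 1 := by simp [h1, hc]
      rw [h2] at hl
      rw [hl.coeff_self, hc, Finset.prod_empty, Algebra.smul_def, mul_one]
    · rw [if_neg fun h => h1 h.1]
      -- This is the only case where the coefficient of w is not at or below the leading one; then d
      -- = 0 and the term is 1.
      by_cases h0 : X.ceilSum d = 0
      · rw [X.eq_zero_of_ceilSum_eq_zero hρ h0 hc, hyperTerm_zero]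
        simp [HahnSeries.coeff_one]
      · exact hl.coeff_of_lt (by omega)
  · rw [if_neg (by rintro ⟨-, h⟩; simp [h] at hc), add_zero]
    by_cases h0 : X.ceilSum d = 0
    · have h2 : X.ceilSum d + (X.negSet d).card = 1 := by simp [h0, hc]
      obtain ⟨k, hk⟩ := Finset.card_eq_one.1 hc
      rw [h2] at hl
      rw [hl.coeff_self, hk, Finset.prod_singleton, Algebra.smul_def]
      rcases k with i | k
      · rw [Finset.sum_eq_single i]
        · simp [h0]
        · intro i' _ hi'
          simp [hi'.symm]
        · simp
      -- An extended index has divisor class zero, which is why the first sum runs over rays only.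
      · simp [divClass]
    · rw [hl.coeff_of_lt (by omega), Finset.sum_eq_zero]
      exact fun i _ => if_neg fun h => h0 h.1

/-! ### The mirror map and the Batyrev elements -/

theorem redI_eq {V : Type*} {p : V → Module.Dual ℤ X.L} {e : V → ℚ} {d : X.LQ}
    (hinj : ∀ d', (∀ a, X.pair (p a) d' = e a) → d' = d) (hd : d ∈ X.Keff)
    (he : ∀ a, X.pair (p a) d = e a) :
    X.redI p e = X.hyperTerm d * HahnSeries.C (X.sectorUnit (X.red d)) :=
  X.monSum_eq hinj hd he

theorem redI_eq_zero {V : Type*} {p : V → Module.Dual ℤ X.L} {e : V → ℚ}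
    (h : ∀ d ∈ X.Keff, ¬ ∀ a, X.pair (p a) d = e a) : X.redI p e = 0 :=
  X.monSum_eq_zero h

end ExtStackyFan

/-! ### Extracting the coefficient of z⁻¹ and differentiating in log y -/

theorem coeff_mul_hahnC {H : Type*} [CommRing H] (T : LaurentSeries H) (u : H) (n : ℤ) :
    (T * HahnSeries.C u).coeff n = T.coeff n * u := by
  rw [mul_comm, HahnSeries.C_apply, HahnSeries.coeff_single_mul, sub_zero, mul_comm]

/-- The coefficient of `w` of `exp (P w) T`, for a power series `T` with constant coefficients. -/
theorem coeff_one_exp_mul {V H : Type*} [CommRing H] [Algebra ℚ H] (P : MvPolynomial V H)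
    (T : LaurentSeries H) (hT : ∀ n < 0, T.coeff n = 0) :
    (((PowerSeries.rescale P (PowerSeries.exp (MvPolynomial V H)) :
        PowerSeries (MvPolynomial V H)) : LaurentSeries (MvPolynomial V H)) *
      T.map (MvPolynomial.C : H →+* MvPolynomial V H)).coeff 1 =
    MvPolynomial.C (T.coeff 1) + P * MvPolynomial.C (T.coeff 0) := by
  have h : T.map (MvPolynomial.C : H →+* MvPolynomial V H) =
      HahnSeries.ofPowerSeries ℤ _ (PowerSeries.mk fun n => MvPolynomial.C (T.coeff n)) := by
    ext1
    funext n
    rw [PowerSeries.coeff_coe, HahnSeries.map_coeff]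
    split_ifs with hn
    · rw [hT n hn, map_zero]
    · rw [PowerSeries.coeff_mk, Int.natCast_natAbs, abs_of_nonneg (not_lt.1 hn)]
  rw [h, ← map_mul]
  have h1 := HahnSeries.ofPowerSeries_apply_coeff (Γ := ℤ)
    (PowerSeries.rescale P (PowerSeries.exp (MvPolynomial V H)) *
      PowerSeries.mk fun n : ℕ => MvPolynomial.C (T.coeff n)) 1
  rw [Nat.cast_one] at h1
  have h2 : Finset.HasAntidiagonal.antidiagonal 1 = {((0 : ℕ), (1 : ℕ)), (1, 0)} := rfl
  rw [h1, PowerSeries.coeff_mul, h2, Finset.sum_pair (by simp)]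
  simp only [PowerSeries.coeff_rescale, PowerSeries.coeff_exp, PowerSeries.coeff_mk, pow_zero,
    pow_one, Nat.factorial, Nat.cast_one, Nat.cast_zero, div_one, map_one, one_mul, mul_one]

open MvPolynomial in
/-- A logarithmic derivative of `u y^e + ∑ (c_a log y_a) w y^e`. -/
theorem sum_smul_yDeriv {A B H : Type*} [Fintype A] [Fintype B] [CommRing H] [Algebra ℚ H]
    (m : A ⊕ B → ℤ) (c : A → H) (F : (A ⊕ B → ℚ) → MvPolynomial (A ⊕ B) H) (e : A ⊕ B → ℚ)
    (u w : H) (hF : F e = C u + (∑ a, C (c a) * X (Sum.inl a)) * C w)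
    (hw : w = 0 ∨ ∑ a, (m a : ℚ) * e a = 0) :
    (∑ a, m a • yDeriv a F) e =
      C (algebraMap ℚ H (∑ a, (m a : ℚ) * e a) * u + (∑ a, (m (Sum.inl a) : H) * c a) * w) := by
  classical
  have h1 : ∀ a, pderiv (Sum.inl a) (F e) = C (c a * w) := by
    intro a
    rw [hF]
    simp [Derivation.leibniz, pderiv_X, Pi.single_apply, mul_comm]
  have h2 : ∀ b, pderiv (Sum.inr b) (F e) = 0 := by
    intro b
    rw [hF]
    simp [Derivation.leibniz, pderiv_X]
  have h3 : (∑ a, (m a : ℚ) * e a) • F e = C (algebraMap ℚ H (∑ a, (m a : ℚ) * e a) * u) := by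
    -- The factor from y^e must not leave a logarithm behind: either no logarithmic term is present,
    -- or the factor is zero.
    rcases hw with hw | hw
    · rw [hF, hw, map_zero, mul_zero, add_zero, Algebra.smul_def, map_mul]
      rfl
    · rw [hw]; simp
  simp only [Finset.sum_apply, Pi.smul_apply, yDeriv, smul_add, Finset.sum_add_distrib]
  rw [map_add, ← h3]
  congr 1
  · rw [Finset.sum_smul]
    refine Finset.sum_congr rfl fun a _ => ?_
    rw [mul_smul, Int.cast_smul_eq_zsmul]
  · rw [Fintype.sum_sum_type]
    simp only [h1, h2, smul_zero, Finset.sum_const_zero, add_zero, zsmul_eq_mul, Finset.sum_mul,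
      map_sum, map_mul, map_intCast, mul_assoc]

namespace ExtStackyFan

variable {N : Type*} [AddCommGroup N] {ι κ : Type*} [Fintype ι] [Fintype κ]
variable (X : ExtStackyFan N ι κ)

theorem mirrorMap_apply {A B : Type*} [Fintype A] (p : A ⊕ B → Module.Dual ℤ X.L) (e : A ⊕ B → ℚ)
    (h : ∀ n < 0, (X.redI p e).coeff n = 0) :
    X.mirrorMap p e = MvPolynomial.C ((X.redI p e).coeff 1) +
      (∑ a : A, MvPolynomial.C (X.cls (p (Sum.inl a))) * MvPolynomial.X (Sum.inl a)) *
        MvPolynomial.C ((X.redI p e).coeff 0) :=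
  coeff_one_exp_mul _ _ h

variable {A B : Type*} [Fintype A] [Fintype B]

theorem batyrev_eq_zero (p : Module.Basis (A ⊕ B) ℤ (Module.Dual ℤ X.L)) (j : ι ⊕ κ)
    {e : A ⊕ B → ℚ} (h : ∀ d ∈ X.Keff, ¬ ∀ a, X.pair (p a) d = e a) : X.batyrev p j e = 0 := by
  have h0 := X.redI_eq_zero h
  rw [batyrev, sum_smul_yDeriv _ (fun a => X.cls (p (Sum.inl a))) _ e 0 0 _ (Or.inl rfl)]
  · simp
  · rw [X.mirrorMap_apply p e (by simp [h0]), h0]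
    simp

/-- The basis determines d from its exponent, so one term survives. Logarithms occur only at d = 0,
where ⟨D_j^S, d⟩ = 0, hence the result is free of them. -/
theorem batyrev_apply (hS : X.IsBoxExtension) (p : Module.Basis (A ⊕ B) ℤ (Module.Dual ℤ X.L))
    (hp : ∀ b, X.cls (p (Sum.inr b)) = 0) (j : ι ⊕ κ) {d : X.LQ} (hd : d ∈ X.Keff)
    (hρ : 0 ≤ X.pair X.rhoS d) :
    X.batyrev p j (fun a => X.pair (p a) d) = MvPolynomial.C
      ((algebraMap ℚ X.Horb (X.pair (X.DS j) d) * (X.hyperTerm d).coeff 1 +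
        X.divClass j * (X.hyperTerm d).coeff 0) * X.sectorUnit (X.red d)) := by
  have h0 := X.redI_eq (p := p) (fun d' h => X.ext_pair_basis p h) hd fun a => rfl
  have h1 : ∀ n, (X.redI p fun a => X.pair (p a) d).coeff n =
      (X.hyperTerm d).coeff n * X.sectorUnit (X.red d) := fun n => by rw [h0, coeff_mul_hahnC]
  rw [batyrev, sum_smul_yDeriv _ (fun a => X.cls (p (Sum.inl a))) _ _ _ _
    (X.mirrorMap_apply p _ fun n hn => by rw [h1, X.hyperTerm_coeff_of_neg hρ hn, zero_mul])]
  · rw [X.sum_repr_smul_cls hS p hp, h1, h1, ← X.pair_eq_sum_repr p]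
    congr 1
    ring
  · rw [← X.pair_eq_sum_repr p]
    by_cases h : d = 0
    · simp [h]
    · left
      rw [h1, X.hyperTerm_coeff_zero hρ h, zero_mul]

end ExtStackyFan

/-! ### The explicit formula for the Batyrev elements -/

namespace ExtStackyFan

variable {N : Type*} [AddCommGroup N] {ι κ : Type*} [Fintype ι] [Fintype κ]
variable (X : ExtStackyFan N ι κ) {A B : Type*} [Fintype A] [Fintype B]

open Classical in
theorem monSum_basis {α : Type*} [Fintype α] (p : Module.Basis α ℤ (Module.Dual ℤ X.L))
    {R : Type*} [AddCommMonoid R] (s : Set X.LQ) (c : X.LQ → R) (d : X.LQ) :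
    X.monSum p s c (fun a => X.pair (p a) d) = if d ∈ s then c d else 0 := by
  split_ifs with h
  · exact X.monSum_eq (fun d' h => X.ext_pair_basis p h) h fun _ => rfl
  · exact X.monSum_eq_zero fun d' hd' h' => h (X.ext_pair_basis p h' ▸ hd')

open Classical in
theorem constSeries_basis {α : Type*} [Fintype α] (p : Module.Basis α ℤ (Module.Dual ℤ X.L))
    {R : Type*} [AddCommMonoid R] (x : R) (d : X.LQ) :
    constSeries x (fun a => X.pair (p a) d) = if d = 0 then x else 0 := by
  have : (fun a => X.pair (p a) d) = 0 ↔ d = 0 := by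
    refine ⟨fun h => X.ext_pair_basis p fun a => ?_, fun h => ?_⟩
    · rw [map_zero]; exact congrFun h a
    · subst h; funext a; simp
  simp only [constSeries, this]

theorem constSeries_eq_zero {α : Type*} (p : α → Module.Dual ℤ X.L)
    {R : Type*} [AddCommMonoid R] (x : R) {e : α → ℚ}
    (h : ∀ d : X.LQ, ¬ ∀ a, X.pair (p a) d = e a) : constSeries x e = 0 := by
  refine if_neg fun he => h 0 fun a => ?_
  rw [he, map_zero, Pi.zero_apply]

theorem red_zero : X.red 0 = 0 := by simp [red]

/-- The comparison is made exponent by exponent: each exponent is realised by at most one d, and the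
coefficient of w of its term is known. -/
theorem batyrev_eq_explicit (hX : X.IsCompleteSimplicial) (hS : X.IsBoxExtension)
    (p : Module.Basis (A ⊕ B) ℤ (Module.Dual ℤ X.L)) (hp : ∀ b, X.cls (p (Sum.inr b)) = 0)
    (hρ : ∀ d ∈ X.Keff, 0 ≤ X.pair X.rhoS d) (j : ι ⊕ κ) (e : A ⊕ B → ℚ) :
    X.batyrev p j e = MvPolynomial.C
      (constSeries (X.D j) e +
        ∑ i, X.divClass (Sum.inl i) *
          X.monSum p (X.untwistedSet i)
            (fun d => (X.Ccoef d * X.pair (X.DS j) d) • X.sectorUnit (X.red d)) e +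
        X.monSum p X.twistedSet
          (fun d => (X.Ccoef d * X.pair (X.DS j) d) • X.sectorUnit (X.red d)) e) := by
  classical
  by_cases he : ∃ d, ∀ a, X.pair (p a) d = e a
  swap
  · have he' := not_exists.1 he
    rw [X.batyrev_eq_zero p j (fun d _ => he' d), X.constSeries_eq_zero p _ he',
      X.monSum_eq_zero fun d _ => he' d,
      Finset.sum_eq_zero fun i _ => by rw [X.monSum_eq_zero fun d _ => he' d, mul_zero]]
    simp
  obtain ⟨d, hd⟩ := he
  obtain rfl : (fun a => X.pair (p a) d) = e := funext hd
  simp only [monSum_basis, constSeries_basis]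
  by_cases hK : d ∈ X.Keff
  · rw [X.batyrev_apply hS p hp j hK (hρ d hK), X.hyperTerm_coeff_one hK (hρ d hK)]
    congr 1
    have h0 : X.divClass j * (X.hyperTerm d).coeff 0 * X.sectorUnit (X.red d) =
        if d = 0 then X.D j else 0 := by
      split_ifs with h
      · rw [h, hyperTerm_zero, red_zero, D, HahnSeries.coeff_one, if_pos rfl, mul_one]
      · rw [X.hyperTerm_coeff_zero (hρ d hK) h, mul_zero, zero_mul]
    rw [← h0, add_mul, add_comm, mul_add, add_mul, ← add_assoc]
    congr 2
    · rw [Finset.mul_sum, Finset.sum_mul]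
      refine Finset.sum_congr rfl fun i _ => ?_
      split_ifs
      · rw [smul_eq_algebraMap_mul, map_mul]; ring
      · simp
    · split_ifs
      · rw [smul_eq_algebraMap_mul, map_mul]; ring
      · simp
  -- Outside 𝕂_eff the right-hand side vanishes too, since 0 and both index sets lie in 𝕂_eff; for
  -- the untwisted sets this uses that each ray is a cone.
  · rw [X.batyrev_eq_zero p j (fun d' hd' h =>
        hK ((X.ext_pair_basis p h : d' = d) ▸ hd')),
      if_neg (fun h : d = 0 => hK (h ▸ X.zero_mem_Keff hX)),
      if_neg (fun h : d ∈ X.twistedSet => hK h.1),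
      Finset.sum_eq_zero fun i _ => by
        rw [if_neg fun h => hK (X.mem_Keff_of_mem_untwistedSet hX h), mul_zero]]
    simp

/-- If `N` is torsion-free, the untwisted part has values in the untwisted sector. -/
theorem divClass_mul_monSum [IsAddTorsionFree N] (p : Module.Basis (A ⊕ B) ℤ (Module.Dual ℤ X.L))
    (c : X.LQ → ℚ) (i : ι) (e : A ⊕ B → ℚ) :
    X.divClass (Sum.inl i) *
        X.monSum p (X.untwistedSet i) (fun d => c d • X.sectorUnit (X.red d)) e =
      X.monSum p (X.untwistedSet i) c e • X.D (Sum.inl i) := by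
  classical
  by_cases he : ∃ d, ∀ a, X.pair (p a) d = e a
  · obtain ⟨d, hd⟩ := he
    obtain rfl : (fun a => X.pair (p a) d) = e := funext hd
    simp only [monSum_basis]
    split_ifs with h
    · have hint : ∀ k, ∃ n : ℤ, X.pair (X.DS k) d = n := by
        intro k
        by_cases hk : k = Sum.inl i
        · obtain ⟨n, -, hn⟩ := h.2.1
          exact ⟨n, hk ▸ hn⟩
        · obtain ⟨n, hn⟩ := h.2.2 k hk
          exact ⟨n, by simpa using hn⟩
      rw [X.red_eq_zero hint, smul_eq_algebraMap_mul, smul_eq_algebraMap_mul, D]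
      ring
    · rw [smul_eq_algebraMap_mul]; simp
  · have he' := not_exists.1 he
    rw [X.monSum_eq_zero fun d _ => he' d, X.monSum_eq_zero fun d _ => he' d,
      smul_eq_algebraMap_mul]
    simp

/-! ### The associated bundle -/

/-- The projection `𝕃^S(ℰ_j) ⊗ ℚ → 𝕃^S ⊗ ℚ`. -/
def projQ (j : ι ⊕ κ) : (X.bundle j).LQ →ₗ[ℚ] X.LQ := LinearMap.baseChange ℚ (X.proj j)

theorem pair_comp_proj (j : ι ⊕ κ) (f : Module.Dual ℤ X.L) (d : (X.bundle j).LQ) :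
    (X.bundle j).pair (f ∘ₗ X.proj j) d = X.pair f (X.projQ j d) := by
  obtain ⟨n, -, x, rfl⟩ := exists_eq_inv_tmul d
  rw [pair_tmul, projQ, LinearMap.baseChange_tmul, pair_tmul, LinearMap.comp_apply]

theorem bundle_coord_eq (j : ι ⊕ κ) (x : (X.bundle j).L) :
    (x : (ι ⊕ Fin 2) ⊕ κ → ℤ) (Sum.inl (Sum.inr 1)) =
      (x : (ι ⊕ Fin 2) ⊕ κ → ℤ) (Sum.inl (Sum.inr 0)) := by
  obtain ⟨x, hx⟩ := x
  have h := congrArg Prod.snd hx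
  simp [betaS, Fintype.linearCombination_apply, bundle, vec, Prod.snd_sum] at h
  simp only
  omega

open Classical in
theorem pair_DS_projQ (j i : ι ⊕ κ) (d : (X.bundle j).LQ) :
    X.pair (X.DS i) (X.projQ j d) = (X.bundle j).pair ((X.bundle j).DS (Sum.map Sum.inl id i)) d +
      if i = j then (X.bundle j).pair ((X.bundle j).DS (Sum.inl (Sum.inr 0))) d else 0 := by
  obtain ⟨n, -, x, rfl⟩ := exists_eq_inv_tmul d
  rw [pair_tmul, projQ, LinearMap.baseChange_tmul, pair_tmul, pair_tmul, DS_apply, DS_apply,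
    DS_apply]
  have h : ((X.proj j x : X.L) : ι ⊕ κ → ℤ) i = (x : (ι ⊕ Fin 2) ⊕ κ → ℤ) (Sum.map Sum.inl id i) +
      if i = j then (x : (ι ⊕ Fin 2) ⊕ κ → ℤ) (Sum.inl (Sum.inr 0)) else 0 := by
    rw [← X.bundle_coord_eq]
    simp [proj, projCoord, LinearMap.funLeft_apply, Pi.single_apply]
  rw [h]
  split_ifs <;> push_cast <;> ring

theorem pair_DS_fibre (j : ι ⊕ κ) (k : Fin 2) (d : (X.bundle j).LQ) :
    (X.bundle j).pair ((X.bundle j).DS (Sum.inl (Sum.inr k))) d =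
      (X.bundle j).pair ((X.bundle j).DS (Sum.inl (Sum.inr 0))) d := by
  obtain ⟨n, -, x, rfl⟩ := exists_eq_inv_tmul d
  rw [pair_tmul, pair_tmul, DS_apply, DS_apply]
  fin_cases k
  · rfl
  · exact congrArg (fun z : ℤ => (z : ℚ) * (n : ℚ)⁻¹) (X.bundle_coord_eq j x)

theorem ext_projQ {j : ι ⊕ κ} {d d' : (X.bundle j).LQ} (h : X.projQ j d = X.projQ j d')
    (h0 : (X.bundle j).pair ((X.bundle j).DS (Sum.inl (Sum.inr 0))) d =
      (X.bundle j).pair ((X.bundle j).DS (Sum.inl (Sum.inr 0))) d') : d = d' := by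
  classical
  have h1 : ∀ i, (X.bundle j).pair ((X.bundle j).DS (Sum.map Sum.inl id i)) d =
      (X.bundle j).pair ((X.bundle j).DS (Sum.map Sum.inl id i)) d' := by
    intro i
    have h2 := X.pair_DS_projQ j i d
    rw [h, X.pair_DS_projQ, h0] at h2
    exact (add_right_cancel h2).symm
  refine (X.bundle j).ext_pair_DS ?_
  rintro ((i | k) | k)
  · exact h1 (Sum.inl i)
  · rw [pair_DS_fibre, h0, X.pair_DS_fibre j k d']
  · exact h1 (Sum.inr k)

/-- The element `(d, 1)` of `𝕃^S(ℰ_j) ⊗ ℚ`. -/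
theorem exists_lift (j : ι ⊕ κ) (d : X.LQ) : ∃ d' : (X.bundle j).LQ, X.projQ j d' = d ∧
    (X.bundle j).pair ((X.bundle j).DS (Sum.inl (Sum.inr 0))) d' = 1 := by
  classical
  obtain ⟨n, hn, x, rfl⟩ := exists_eq_inv_tmul d
  have hx : X.betaS (x : ι ⊕ κ → ℤ) = 0 := x.2
  -- Both fibre coordinates are set to n, so that they become 1 after division by n; the b_j
  -- contributed by (b_j, -1) is compensated by subtracting n at the index j.
  let y : ι ⊕ κ → ℤ := (x : ι ⊕ κ → ℤ) - (n : ℤ) • Pi.single j 1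
  have hy : X.betaS y + (n : ℤ) • X.vec j = 0 := by
    rw [map_sub, hx, map_smul, betaS, Fintype.linearCombination_apply_single, one_smul]
    simp
  let x' : (ι ⊕ Fin 2) ⊕ κ → ℤ :=
    Sum.elim (Sum.elim (fun i => y (Sum.inl i)) fun _ => n) fun k => y (Sum.inr k)
  have hx' : (X.bundle j).betaS x' = 0 := by
    rw [betaS, Fintype.linearCombination_apply, Fintype.sum_sum_type] at hy
    rw [betaS, Fintype.linearCombination_apply]
    ext
    · rw [Prod.fst_zero, ← hy]
      simp [x', bundle, vec, Prod.fst_sum]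
      abel
    · simp [x', bundle, vec, Prod.snd_sum]
  refine ⟨(n : ℚ)⁻¹ ⊗ₜ[ℤ] ⟨x', hx'⟩, ?_, ?_⟩
  · rw [projQ, LinearMap.baseChange_tmul]
    congr 1
    ext i
    rcases i with i | i <;>
      simp [proj, projCoord, LinearMap.funLeft_apply, x', y, Pi.single_apply]
  · rw [pair_tmul, DS_apply]
    have hn' : (n : ℚ) ≠ 0 := by positivity
    simp [x', hn']

-- Both fibre divisors pair to 1 with d', so neither fibre ray belongs to the cone attached to d',
-- which is therefore a cone of the original fan.
open Classical in
theorem mem_Keff_bundle_iff {j : ι ⊕ κ} {d' : (X.bundle j).LQ} {d : X.LQ}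
    (hd : X.projQ j d' = d)
    (h0 : (X.bundle j).pair ((X.bundle j).DS (Sum.inl (Sum.inr 0))) d' = 1) :
    d' ∈ (X.bundle j).Keff ↔
      X.AntiCone {i | ∃ n : ℕ, X.pair (X.DS i) d - (if i = j then 1 else 0) = n} := by
  have h1 : ∀ i, X.pair (X.DS i) d - (if i = j then 1 else 0) =
      (X.bundle j).pair ((X.bundle j).DS (Sum.map Sum.inl id i)) d' := by
    intro i
    rw [← hd, pair_DS_projQ, h0, add_sub_cancel_right]
  simp only [h1]
  constructor
  · rintro ⟨h2, τ, ⟨⟨σ, hσ, hστ⟩, -⟩, hτ⟩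
    exact ⟨h2, σ, hσ, fun i => (hστ i).trans (hτ _)⟩
  · rintro ⟨h2, σ, hσ, h3⟩
    refine ⟨h2, σ.map Function.Embedding.inl, ⟨⟨σ, hσ, by simp⟩, by simp⟩, ?_⟩
    rintro (i | k)
    · have : Sum.inl i ∈ σ.map (Function.Embedding.inl : ι ↪ ι ⊕ Fin 2) ↔ i ∈ σ := by simp
      exact this.trans (h3 i)
    · have : (Sum.inr k : ι ⊕ Fin 2) ∉ σ.map Function.Embedding.inl := by simp
      refine iff_of_false this (not_not.2 ⟨1, ?_⟩)
      rw [pair_DS_fibre, h0, Nat.cast_one]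

/-- The b_j lost by lowering the pairing with D_j is restored by the ray (b_j, -1), whose last
coordinate cancels that of (0, 1). -/
theorem red_bundle {j : ι ⊕ κ} {d' : (X.bundle j).LQ} {d : X.LQ} (hd : X.projQ j d' = d)
    (h0 : (X.bundle j).pair ((X.bundle j).DS (Sum.inl (Sum.inr 0))) d' = 1) :
    (X.bundle j).red d' = (X.red d, 0) := by
  classical
  have h1 : ∀ i, ⌈X.pair (X.DS i) d⌉ =
      ⌈(X.bundle j).pair ((X.bundle j).DS (Sum.map Sum.inl id i)) d'⌉ +
        if i = j then 1 else 0 := by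
    intro i
    rw [← hd, pair_DS_projQ, h0]
    split_ifs <;> simp
  have h2 : X.red d = ∑ i,
      ⌈(X.bundle j).pair ((X.bundle j).DS (Sum.map Sum.inl id i)) d'⌉ • X.vec i + X.vec j := by
    simp only [red, h1, add_smul, Finset.sum_add_distrib, ite_smul, one_smul, zero_smul,
      Finset.sum_ite_eq', Finset.mem_univ, if_true]
  rw [h2, red]
  simp only [Fintype.sum_sum_type, Fin.sum_univ_two, pair_DS_fibre, h0, Int.ceil_one, one_smul]
  ext
  · simp [bundle, vec, Prod.fst_sum]
    abel
  · simp [bundle, vec, Prod.snd_sum]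

/-! ### Restriction to a fibre -/

theorem fibrePullback_divClass (j i : ι ⊕ κ) :
    X.fibrePullback j ((X.bundle j).divClass (Sum.map Sum.inl id i)) = X.divClass i := by
  funext v
  rcases i with i | i
  · simp [fibrePullback, divClass, fibrePoly]
  · simp [fibrePullback, divClass]

theorem fibrePullback_divClass_fibre (j : ι ⊕ κ) (k : Fin 2) :
    X.fibrePullback j ((X.bundle j).divClass (Sum.inl (Sum.inr k))) = 0 := by
  funext v
  simp [fibrePullback, divClass, fibrePoly]

theorem fibrePullback_sectorUnit (j : ι ⊕ κ) (v : N) :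
    X.fibrePullback j ((X.bundle j).sectorUnit (v, 0)) = X.sectorUnit v := by
  classical
  funext u
  by_cases h : (u : N) = v
  · simp [fibrePullback, sectorUnit, h]
  · simp [fibrePullback, sectorUnit, h]

/-- The restriction of a term of the `I`-function of `ℰ_j` of degree one over `ℙ¹` to a fibre. -/
theorem laurentMap_hyperTerm {j : ι ⊕ κ} {d' : (X.bundle j).LQ} {d : X.LQ}
    (hd : X.projQ j d' = d)
    (h0 : (X.bundle j).pair ((X.bundle j).DS (Sum.inl (Sum.inr 0))) d' = 1) :
    laurentMap (X.fibrePullback j) ((X.bundle j).hyperTerm d') =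
      HahnSeries.single 2 1 * (linFactor (X.divClass j) (X.pair (X.DS j) d) * X.hyperTerm d) := by
  classical
  have h1 : ∀ i, hyperFactor (X.fibrePullback j ((X.bundle j).divClass (Sum.map Sum.inl id i)))
        ((X.bundle j).pair ((X.bundle j).DS (Sum.map Sum.inl id i)) d') =
      (if i = j then linFactor (X.divClass j) (X.pair (X.DS j) d) else 1) *
        hyperFactor (X.divClass i) (X.pair (X.DS i) d) := by
    intro i
    have h2 := X.pair_DS_projQ j i d'
    rw [hd, h0] at h2
    rw [fibrePullback_divClass, ← sub_eq_of_eq_add h2]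
    split_ifs with h
    · rw [h, hyperFactor_sub_one]
    · rw [sub_zero, one_mul]
  have h3 : linFactor (X.divClass j) (X.pair (X.DS j) d) * X.hyperTerm d =
      ∏ i, hyperFactor (X.fibrePullback j ((X.bundle j).divClass (Sum.map Sum.inl id i)))
        ((X.bundle j).pair ((X.bundle j).DS (Sum.map Sum.inl id i)) d') := by
    simp only [h1, Finset.prod_mul_distrib, Finset.prod_ite_eq', Finset.mem_univ, if_true]
    rfl
  -- The factor w² splits as w · w, one for each of the two fibre divisors.
  have h4 : (HahnSeries.single 2 1 : LaurentSeries X.Horb) =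
      HahnSeries.single 1 1 * HahnSeries.single 1 1 := by
    rw [HahnSeries.single_mul_single, one_mul]; rfl
  rw [h3, h4, hyperTerm, map_prod]
  simp only [laurentMap_hyperFactor, Fintype.prod_sum_type, Fin.prod_univ_two, pair_DS_fibre, h0,
    fibrePullback_divClass_fibre, hyperFactor_one_zero, Sum.map_inl, Sum.map_inr, id_eq]
  ring

theorem pair_bundleBasis_iff {j : ι ⊕ κ} {A B : Type*} {p : A ⊕ B → Module.Dual ℤ X.L}
    {d' : (X.bundle j).LQ} {e : A ⊕ B → ℚ} :
    (∀ a, (X.bundle j).pair (X.bundleBasis j p a) d' = consExp 1 e a) ↔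
      (X.bundle j).pair ((X.bundle j).DS (Sum.inl (Sum.inr 0))) d' = 1 ∧
        ∀ a, X.pair (p a) (X.projQ j d') = e a := by
  constructor
  · intro h
    refine ⟨by simpa [bundleBasis, consExp] using h (Sum.inl none), ?_⟩
    rintro (a | b)
    · rw [← pair_comp_proj]; exact h (Sum.inl (some a))
    · rw [← pair_comp_proj]; exact h (Sum.inr b)
  · rintro ⟨h0, h⟩ ((_ | a) | b)
    · simpa [bundleBasis, consExp] using h0
    · exact (X.pair_comp_proj j _ d').trans (h (Sum.inl a))
    · exact (X.pair_comp_proj j _ d').trans (h (Sum.inr b))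

theorem mem_Keff_of_bundle (hX : X.IsCompleteSimplicial) {j : ι ⊕ κ} {d' : (X.bundle j).LQ}
    (h0 : (X.bundle j).pair ((X.bundle j).DS (Sum.inl (Sum.inr 0))) d' = 1)
    (h : d' ∈ (X.bundle j).Keff) : X.projQ j d' ∈ X.Keff := by
  classical
  obtain ⟨h1, σ, hσ, h2⟩ := (X.mem_Keff_bundle_iff rfl h0).1 h
  have h3 : ∀ i, (∃ n : ℕ, X.pair (X.DS i) (X.projQ j d') - (if i = j then 1 else 0) = n) →
      ∃ n : ℕ, X.pair (X.DS i) (X.projQ j d') = n := by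
    rintro i ⟨n, hn⟩
    refine ⟨n + if i = j then 1 else 0, ?_⟩
    rw [sub_eq_iff_eq_add.1 hn]
    split_ifs <;> simp
  -- Adding 1 to the pairing with D_j can only enlarge the set of non-negative integral pairings, so
  -- the complement shrinks to a face of σ.
  refine ⟨fun k => h3 _ (h1 k), σ.filter fun i => ¬ ∃ n : ℕ,
    X.pair (X.DS (Sum.inl i)) (X.projQ j d') = n, hX.face σ hσ _ (Finset.filter_subset _ _), ?_⟩
  intro i
  rw [Finset.mem_filter, h2 i]
  exact ⟨fun h => h.2, fun h => ⟨fun h' => h (h3 _ h'), h⟩⟩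

/-- The terms of the `I`-function of `𝒳` that are not the restriction of a term for `ℰ_j` do not
contribute. -/
theorem coeff_linFactor_mul_hyperTerm_eq_zero (hX : X.IsCompleteSimplicial) {j : ι ⊕ κ}
    {d' : (X.bundle j).LQ} {d : X.LQ} (hd : X.projQ j d' = d)
    (h0 : (X.bundle j).pair ((X.bundle j).DS (Sum.inl (Sum.inr 0))) d' = 1)
    (hK : d ∈ X.Keff) (hρ : 0 ≤ X.pair X.rhoS d) (h : d' ∉ (X.bundle j).Keff) :
    (linFactor (X.divClass j) (X.pair (X.DS j) d) * X.hyperTerm d).coeff 0 = 0 := by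
  classical
  rw [X.mem_Keff_bundle_iff hd h0] at h
  -- Subtracting 1 changes whether the pairing with D_j is a non-negative integer only if that
  -- pairing is 0.
  have hj : X.pair (X.DS j) d = 0 := by
    by_contra hj
    apply h
    have hset : {i | ∃ n : ℕ, X.pair (X.DS i) d - (if i = j then 1 else 0) = n} =
        {i | ∃ n : ℕ, X.pair (X.DS i) d = n} := by
      refine Set.ext fun i => ?_
      simp only [Set.mem_ofPred_eq]
      split_ifs with hi
      · subst hi
        constructor
        · rintro ⟨n, hn⟩
          exact ⟨n + 1, by push_cast; linarith⟩
        · rintro ⟨n, hn⟩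
          obtain ⟨k, rfl⟩ : ∃ k, n = k + 1 := Nat.exists_eq_succ_of_ne_zero (by
            rintro rfl; exact hj (by simpa using hn))
          exact ⟨k, by push_cast at hn; linarith⟩
      · rw [sub_zero]
    rw [hset]
    exact hK
  rw [coeff_linFactor_mul, hj, map_zero, zero_mul, add_zero]
  by_cases hd0 : d = 0
  · rcases j with i | k
    · exfalso
      apply h
      -- For d = 0 and j a ray, (0, 1) is effective after all: the complement of its anticone is the
      -- ray {j}.
      refine ⟨fun k => ⟨0, by simp [hd0]⟩, {i}, hX.ray_mem i, fun i' => ?_⟩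
      rw [Finset.mem_singleton]
      constructor
      · rintro rfl ⟨n, hn⟩
        simp [hd0] at hn
        have : (0 : ℚ) ≤ n := Nat.cast_nonneg n
        linarith
      · intro h'
        by_contra hi
        exact h' ⟨0, by simp [hd0, hi]⟩
    · simp [divClass]
  · rw [X.hyperTerm_coeff_zero hρ hd0, mul_zero]

/-- Each exponent e comes from at most one d, and y_0 y^e from its unique lift (d, 1); it remains to
match the two terms, or to see that the term on 𝒳 vanishes when the lift is not effective. -/
theorem batyrev_eq_fibrePullback (hX : X.IsCompleteSimplicial) (hS : X.IsBoxExtension)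
    (p : Module.Basis (A ⊕ B) ℤ (Module.Dual ℤ X.L)) (hp : ∀ b, X.cls (p (Sum.inr b)) = 0)
    (hρ : ∀ d ∈ X.Keff, 0 ≤ X.pair X.rhoS d) (j : ι ⊕ κ) (e : A ⊕ B → ℚ) :
    X.batyrev p j e = MvPolynomial.C (X.fibrePullback j (X.G j p 1 e)) := by
  by_cases he : ∃ d ∈ X.Keff, ∀ a, X.pair (p a) d = e a
  swap
  · have hG : (X.bundle j).redI (X.bundleBasis j p) (consExp 1 e) = 0 :=
      redI_eq_zero _ fun d' hd' h => he
        ⟨_, X.mem_Keff_of_bundle hX (X.pair_bundleBasis_iff.1 h).1 hd',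
          (X.pair_bundleBasis_iff.1 h).2⟩
    rw [X.batyrev_eq_zero p j fun d hd h => he ⟨d, hd, h⟩, G, hG]
    simp
  obtain ⟨d, hK, hd⟩ := he
  obtain rfl : (fun a => X.pair (p a) d) = e := funext hd
  obtain ⟨d', rfl, h0⟩ := X.exists_lift j d
  have hcoeff := coeff_linFactor_mul (X.divClass j) (X.pair (X.DS j) (X.projQ j d'))
    (X.hyperTerm (X.projQ j d')) 0
  rw [zero_add, add_comm] at hcoeff
  rw [X.batyrev_apply hS p hp j hK (hρ _ hK), ← hcoeff]
  congr 1
  have huniq : ∀ d'' : (X.bundle j).LQ, (∀ a, (X.bundle j).pair (X.bundleBasis j p a) d'' =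
      consExp 1 (fun a => X.pair (p a) (X.projQ j d')) a) → d'' = d' := by
    intro d'' h
    obtain ⟨h1, h2⟩ := X.pair_bundleBasis_iff.1 h
    exact X.ext_projQ (X.ext_pair_basis p h2) (h1.trans h0.symm)
  by_cases hK' : d' ∈ (X.bundle j).Keff
  -- The factor w² shifts the coefficient of index 2 to that of index 0.
  · rw [G, redI_eq _ huniq hK' (X.pair_bundleBasis_iff.2 ⟨h0, fun _ => rfl⟩), coeff_mul_hahnC,
      map_mul, X.red_bundle rfl h0, fibrePullback_sectorUnit, ← laurentMap_coeff,
      X.laurentMap_hyperTerm rfl h0, HahnSeries.coeff_single_mul, one_mul, sub_self]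
  · have hG : (X.bundle j).redI (X.bundleBasis j p)
        (consExp 1 fun a => X.pair (p a) (X.projQ j d')) = 0 :=
      redI_eq_zero _ fun d'' hd'' h => hK' (huniq d'' h ▸ hd'')
    rw [X.coeff_linFactor_mul_hyperTerm_eq_zero hX rfl h0 hK (hρ _ hK) hK', G, hG]
    simp

end ExtStackyFan

end

/-! ### The lemma on Batyrev elements -/

theorem mainTheorem8 {N : Type*} [AddCommGroup N] [Module.Finite ℤ N] {m l r : ℕ}
    (X : ExtStackyFan N (Fin m) (Fin l))
    (hX : X.IsCompleteSimplicial)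
    (hS : X.IsBoxExtension)
    (p : Module.Basis (Fin r ⊕ Fin l) ℤ (Module.Dual ℤ X.L))
    (hp : ∀ a, X.toReal (p a) ∈ closure X.kahlerCone)
    (hp_ext : ∀ b : Fin l, ∃ c : Fin l → ℝ, (∀ k, 0 ≤ c k) ∧
      X.toReal (p (Sum.inr b)) = ∑ k, c k • X.toReal (X.DS (Sum.inr k)))
    (hρ : X.toReal X.rhoS ∈ closure X.kahlerCone)
    (j : Fin m ⊕ Fin l) :
    (X.batyrev p j = fun e => MvPolynomial.C (X.fibrePullback j (X.G j p 1 e))) ∧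
    (X.batyrev p j = fun e => MvPolynomial.C
      (ExtStackyFan.constSeries (X.D j) e +
        ∑ i : Fin m, X.divClass (Sum.inl i) *
          X.monSum p (X.untwistedSet i)
            (fun d => (X.Ccoef d * X.pair (X.DS j) d) • X.sectorUnit (X.red d)) e +
        X.monSum p X.twistedSet
          (fun d => (X.Ccoef d * X.pair (X.DS j) d) • X.sectorUnit (X.red d)) e)) ∧
    (IsAddTorsionFree N →
      X.batyrev p j = fun e => MvPolynomial.C
        (ExtStackyFan.constSeries (X.D j) e +
          ∑ i : Fin m, X.monSum p (X.untwistedSet i)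
            (fun d => X.Ccoef d * X.pair (X.DS j) d) e • X.D (Sum.inl i) +
          X.monSum p X.twistedSet
            (fun d => (X.Ccoef d * X.pair (X.DS j) d) • X.sectorUnit (X.red d)) e)) := by
  have hcls : ∀ b, X.cls (p (Sum.inr b)) = 0 := fun b => by
    obtain ⟨c, -, hc⟩ := hp_ext b
    exact X.cls_eq_zero hS hc
  have hρ' : ∀ d ∈ X.Keff, 0 ≤ X.pair X.rhoS d := fun d hd => X.pair_nonneg_of_mem_closure hρ hd
  refine ⟨funext fun e => X.batyrev_eq_fibrePullback hX hS p hcls hρ' j e,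
    funext fun e => X.batyrev_eq_explicit hX hS p hcls hρ' j e, fun _ => funext fun e => ?_⟩
  rw [X.batyrev_eq_explicit hX hS p hcls hρ' j e]
  simp only [X.divClass_mul_monSum p]
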